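/- Fix an algebraic closure $\overline{\mathbb Q}$ of $\mathbb Q$; all number fields are subfields of $\overline{\mathbb Q}$. Let $H$ be the absolute multiplicative Weil height on $\overline{\mathbb Q}$. For positive integers $e,n$ and real $X>0$ let $$Z(e,n,X)=\bigl|\{\alpha\in\overline{\mathbb Q}:[\mathbb Q(\alpha):\mathbb Q]=en,\ \mathbb Q(\alpha)\text{ contains a field of degree } e \text{ over } \mathbb Q,\ H(\alpha)\le X\}\bigr|.$$ For $\alpha\in\overline{\mathbb Q}$ let $D_\alpha\in\mathbb Z[x]$ be its minimal polynomial with coprime coefficients and positive leading coefficient, let $|D_\alpha|$ be the maximum of the absolute values of its coefficients, and for a number field $L$ put $\pi(L)=\inf\{|D_\alpha| : \mathbb Q(\alpha)=L\}$. (1) For all positive integers $e,n$ and every real $X>0$ the number $Z(e,n,X)$ is finite and $$Z(e,n,X)\le c\,X^{en(n+e)},\qquad c=n\cdot 2^{e(n^2+ne+2e+n+13)+n^2+10n}.$$ (2) When number fields are ordered by $\pi$, those of a given degree $d=en>6$ that have a nontrivial subfield have density zero. That is, for every integer $d>6$ and every real $X$ there are only finitely many number fields $L$ of degree $d$ with $\pi(L)\le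 X$, there is at least one if $X$ is large enough, and $$\lim_{X\to\infty}\frac{|\{L:[L:\mathbb Q]=d,\ \pi(L)\le X,\ \text{there is a field } K \text{ with } \mathbb Q\subsetneq K\subsetneq L\}|}{|\{L:[L:\mathbb Q]=d,\ \pi(L)\le X\}|}=0.$$ -/

import Mathlib

open Polynomial IntermediateField

/-- The fixed algebraic closure of `ℚ`; all number fields are subfields of it. -/
abbrev Qbar : Type := AlgebraicClosure ℚ

instance : Algebra.IsAlgebraic ℚ Qbar := by
  have h := AlgebraicClosure.isAlgebraic ℚ
  rwa [Subsingleton.elim (AlgebraicClosure.instAlgebra ℚ) DivisionRing.toRatAlgebra] at h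

/-- `D` is a minimal polynomial of `α` over `ℤ`: a rational multiple of the monic minimal
polynomial over `ℚ`, with coprime integer coefficients and positive leading coefficient. -/
def IsIntMinpoly (α : Qbar) (D : ℤ[X]) : Prop :=
  D.IsPrimitive ∧ 0 < D.leadingCoeff ∧
    D.map (Int.castRingHom ℚ) = C (D.leadingCoeff : ℚ) * minpoly ℚ α

theorem existsUnique_isIntMinpoly (α : Qbar) : ∃! D : ℤ[X], IsIntMinpoly α D := by
  have hα : IsIntegral ℚ α := Algebra.IsIntegral.isIntegral α
  have hm := minpoly.monic hα
  have hinj : Function.Injective (Int.castRingHom ℚ) := Int.cast_injective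
  obtain ⟨b, hb, hbp⟩ :=
    IsLocalization.integerNormalization_spec (nonZeroDivisors ℤ) (minpoly ℚ α)
  set p := IsLocalization.integerNormalization (nonZeroDivisors ℤ) (minpoly ℚ α)
  have hb0 : b ≠ 0 := nonZeroDivisors.ne_zero hb
  have hbp' : p.map (Int.castRingHom ℚ) = C (b : ℚ) * minpoly ℚ α := by
    rw [show Int.castRingHom ℚ = algebraMap ℤ ℚ from rfl, hbp]
    ext i
    simp
  have hlead : ∀ (q : ℤ[X]) (c : ℚ), q.map (Int.castRingHom ℚ) = C c * minpoly ℚ α →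
      (q.leadingCoeff : ℚ) = c := by
    intro q c h
    have := congrArg leadingCoeff h
    rw [leadingCoeff_map_of_injective hinj, leadingCoeff_mul, hm.leadingCoeff,
      leadingCoeff_C, mul_one] at this
    simpa using this
  have hp0 : p ≠ 0 := by
    intro h
    have := hlead p b hbp'
    rw [h] at this
    exact hb0 (by simpa using this.symm)
  have hc0 : (p.content : ℚ) ≠ 0 := by
    exact_mod_cast (content_eq_zero_iff.not.mpr hp0)
  -- the primitive part is a rational multiple of the minimal polynomial
  have hprim : p.primPart.map (Int.castRingHom ℚ) =
      C ((b : ℚ) / p.content) * minpoly ℚ α := by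
    have h1 : (C p.content * p.primPart).map (Int.castRingHom ℚ) =
        C (b : ℚ) * minpoly ℚ α := by rw [← p.eq_C_content_mul_primPart, hbp']
    rw [Polynomial.map_mul, map_C] at h1
    have h2 : C (p.content : ℚ) * p.primPart.map (Int.castRingHom ℚ) =
        C (b : ℚ) * minpoly ℚ α := by simpa using h1
    rw [div_eq_inv_mul, C_mul, mul_assoc, ← h2, ← mul_assoc, ← C_mul, inv_mul_cancel₀ hc0]
    simp
  have hpp0 : p.primPart.leadingCoeff ≠ 0 :=
    leadingCoeff_ne_zero.mpr p.isPrimitive_primPart.ne_zero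
  have hex : ∃ D : ℤ[X], IsIntMinpoly α D := by
    rcases lt_or_gt_of_ne hpp0 with h | h
    · refine ⟨-p.primPart, ?_, ?_, ?_⟩
      · intro r hr
        exact p.isPrimitive_primPart r ((dvd_neg).mp hr)
      · rw [leadingCoeff_neg]; omega
      · rw [leadingCoeff_neg, Polynomial.map_neg, hprim, Int.cast_neg, hlead _ _ hprim]
        simp
    · refine ⟨p.primPart, p.isPrimitive_primPart, h, ?_⟩
      rw [hlead _ _ hprim]
      exact hprim
  obtain ⟨D, hD⟩ := hex
  refine ⟨D, hD, ?_⟩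
  intro E hE
  have key : C D.leadingCoeff * E = C E.leadingCoeff * D := by
    apply map_injective _ hinj
    rw [Polynomial.map_mul, Polynomial.map_mul, hD.2.2, hE.2.2, map_C, map_C]
    simp only [eq_intCast]
    ring
  have hcont := congrArg content key
  rw [content_C_mul, content_C_mul, hD.1.content_eq_one, hE.1.content_eq_one, mul_one, mul_one,
    Int.normalize_of_nonneg hD.2.1.le, Int.normalize_of_nonneg hE.2.1.le] at hcont
  rw [hcont] at key
  exact mul_left_cancel₀ (C_ne_zero.mpr hE.2.1.ne') key

/-- The unique minimal polynomial `D_α ∈ ℤ[x]` of `α` with coprime coefficients and positive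
leading coefficient. -/
noncomputable def intMinpoly (α : Qbar) : ℤ[X] :=
  (existsUnique_isIntMinpoly α).choose

theorem intMinpoly_spec (α : Qbar) : IsIntMinpoly α (intMinpoly α) :=
  (existsUnique_isIntMinpoly α).choose_spec.1

/-- The naive height `|D_α|`: the maximum norm of the coefficient vector of `D_α`. -/
noncomputable def naiveHeight (α : Qbar) : ℝ :=
  (intMinpoly α).supNorm

/-- `π(L)`: the infimum of the naive heights of the generators of `L` over `ℚ`. For `L` of
finite degree a generator exists. -/
noncomputable def fieldPi (L : IntermediateField ℚ Qbar) : ℝ :=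
  sInf (naiveHeight '' {α : Qbar | ℚ⟮α⟯ = L})

/-- The set counted by `Z(e, n, X)`: the algebraic numbers `α` of degree `e * n` such that `ℚ(α)`
contains a field of degree `e` and whose absolute multiplicative Weil height is at most `X`. -/
def numbersWithSubfield (e n : ℕ) (X : ℝ) : Set Qbar :=
  {α | Module.finrank ℚ ℚ⟮α⟯ = e * n ∧
    (∃ K : IntermediateField ℚ Qbar, K ≤ ℚ⟮α⟯ ∧ Module.finrank ℚ K = e) ∧
    NumberField.absMulHeight₁ α ≤ X}

/-- The number fields `L` of degree `d` (`d` positive) with `π(L) ≤ X`. -/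
def fieldsOfDegree (d : ℕ) (X : ℝ) : Set (IntermediateField ℚ Qbar) :=
  {L | Module.finrank ℚ L = d ∧ fieldPi L ≤ X}

/-- Those number fields `L` of degree `d` with `π(L) ≤ X` that have a subfield different from `ℚ`
and from `L`. -/
def fieldsWithSubfield (d : ℕ) (X : ℝ) : Set (IntermediateField ℚ Qbar) :=
  {L | L ∈ fieldsOfDegree d X ∧ ∃ K : IntermediateField ℚ Qbar, K ≤ L ∧ K ≠ ⊥ ∧ K ≠ L}

/-! ### Two principles of finite counting. -/

section Counting

/-! Part (1). Let `ℚ(α)` have degree `en` and contain `K` of degree `e`. The `n` lower coefficients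
of the minimal polynomial of `α` over `K` generate `K`: a smaller field would make the degree of `α`
too small. Their height relative to `K` is at most `2^(ne) H(α)^(en)` (`exists_tuple`). At most `n`
numbers share a tuple, so it suffices to count `n`-tuples that generate a field of degree `e` and
have relative height at most `Z`; the target is a constant times `Z^(n+e)`
(`card_tuples_generating_le`).

The engine is `card_tuples_le`: inside a fixed field, a partial tuple `b` of `k` entries has `≪
(Z/H(b))^2 Z^(n-k)` completions of height at most `Z`. The square comes from summing over the
possible denominator ideals and archimedean sizes, and each remaining entry then lies in a box of a
fractional ideal (`card_box_le`).

If a single entry `β` generates the field, there are `≪ T^(e+1)` choices of `β` with Mahler measure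
at most `T`. Summing `(Z/M(β))^2 Z^(n-1)` over them gives `Z^(n+e)`, because `e + 1 > 2` when `e ≥
2` (`card_tuples_simple_le`). Otherwise some `k ≥ 2` entries generate the field and all entries have
degree at most `d` with `kd ≤ e` (`exists_chain`); entries of such small degree are few enough for a
crude count (`card_tuples_chain_le`). The case `e = 1` is a direct count of integer polynomials.

Part (2). A field with `π(L) ≤ X` has a generator with `H(α)^d ≪ X`
(`absMulHeight₁_pow_le_naiveHeight`), so part (1) gives `≪ X^(n+e)` fields with a subfield of degree
`e`, where `en = d` and `n + e ≤ d - 2` because `d > 6`. In the other direction, there are about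
`X^d` Eisenstein polynomials of naive height at most `X`, and one field contains roots of at most `≪
X (log X)^d` of them (`card_integers_le`). Hence there are `≫ X^(d-1)/(log X)^d` fields in all, and
the ratio is `≪ (log X)^d / X`. -/

theorem finite_and_ncard_le {α : Type*} {s : Set α} {C : ℝ}
    (h : ∀ F : Finset α, ↑F ⊆ s → (F.card : ℝ) ≤ C) : s.Finite ∧ (s.ncard : ℝ) ≤ C := by
  have hfin : s.Finite := by
    by_contra hinf
    obtain ⟨F, hF, hc⟩ := Set.Infinite.exists_subset_card_eq hinf (⌊C⌋₊ + 1)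
    have h1 := h F hF
    rw [hc] at h1
    push_cast at h1
    exact absurd h1 (not_le.mpr (Nat.lt_floor_add_one C))
  refine ⟨hfin, ?_⟩
  rw [Set.ncard_eq_toFinset_card s hfin]
  exact h _ (by simp)

theorem card_le_sum_image {α β : Type*} [DecidableEq β] (F : Finset α) (f : α → β) (w : β → ℝ)
    (h : ∀ a ∈ F, ((F.filter (fun x => f x = f a)).card : ℝ) ≤ w (f a)) :
    (F.card : ℝ) ≤ ∑ b ∈ F.image f, w b := by
  rw [Finset.card_eq_sum_card_image f F]
  push_cast
  refine Finset.sum_le_sum fun b hb => ?_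
  obtain ⟨a, ha, rfl⟩ := Finset.mem_image.mp hb
  exact h a ha

end Counting

/-! ### Denominator ideals and lattice points in boxes. -/

section Denominators

open NumberField

variable {K : Type*} [Field K]

/-- The ideal of common denominators of a tuple of elements of a number field. -/
def denomIdeal {ι : Type*} (c : ι → K) : Ideal (𝓞 K) where
  carrier := {r | ∀ i, IsIntegral ℤ ((r : K) * c i)}
  add_mem' {a b} ha hb i := by
    simpa [add_mul] using (ha i).add (hb i)
  zero_mem' i := by simpa using isIntegral_zero
  smul_mem' a r hr i := by
    simpa [mul_assoc] using a.isIntegral_coe.mul (hr i)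

theorem denomIdeal_le_comp {ι κ : Type*} (c : ι → K) (f : κ → ι) :
    denomIdeal c ≤ denomIdeal (c ∘ f) := fun _ hr i => hr (f i)

/-- The real form `Re + Im`, taken at `σ` and at its conjugate, controls `‖σ x‖`. This puts real and
complex embeddings on the same footing. -/
theorem norm_embedding_sq (σ : K →+* ℂ) (x : K) :
    ‖σ x‖ ^ 2 = (((σ x).re + (σ x).im) ^ 2 +
      ((ComplexEmbedding.conjugate σ x).re + (ComplexEmbedding.conjugate σ x).im) ^ 2) / 2 := by
  rw [Complex.sq_norm, Complex.normSq_apply]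
  simp only [ComplexEmbedding.conjugate_coe_eq, Complex.conj_re, Complex.conj_im]
  ring

variable [NumberField K]

theorem denomIdeal_ne_bot {ι : Type*} [Finite ι] (c : ι → K) : denomIdeal c ≠ ⊥ := by
  obtain ⟨b, hb⟩ := IsLocalization.exist_integer_multiples_of_finite (nonZeroDivisors (𝓞 K)) c
  intro h
  have hmem : (b : 𝓞 K) ∈ denomIdeal c := by
    intro i
    obtain ⟨y, hy⟩ := hb i
    have : ((b : 𝓞 K) : K) * c i = (y : K) := by
      simpa [Submonoid.smul_def, Algebra.smul_def] using hy.symm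
    rw [this]
    exact y.isIntegral_coe
  rw [h] at hmem
  simp at hmem

theorem absNorm_denomIdeal_pos {ι : Type*} [Finite ι] (c : ι → K) :
    0 < Ideal.absNorm (denomIdeal c) :=
  Nat.pos_of_ne_zero fun h => denomIdeal_ne_bot c (Ideal.absNorm_eq_zero_iff.mp h)

theorem prod_norm_embeddings (x : K) : ∏ σ : K →+* ℂ, ‖σ x‖ = |(Algebra.norm ℚ x : ℚ)| := by
  have h := Algebra.norm_eq_prod_embeddings ℚ ℂ x
  have h2 : ‖algebraMap ℚ ℂ (Algebra.norm ℚ x)‖ = |(Algebra.norm ℚ x : ℚ)| := by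
    simp
  rw [← h2, h, norm_prod]
  exact Fintype.prod_equiv (RingHom.equivRatAlgHom K ℂ) _ _ (fun σ => rfl)

theorem prod_norm_embeddings_int (x : 𝓞 K) :
    ∏ σ : K →+* ℂ, ‖σ x‖ = Ideal.absNorm (Ideal.span {x}) := by
  rw [prod_norm_embeddings, Ideal.absNorm_span_singleton, Nat.cast_natAbs,
    ← Algebra.coe_norm_int]
  push_cast
  rfl

/-- With `x = y/m` the hypothesis says `I (y) ⊆ (m)`, and a nonzero ideal contained in another has
at least its norm. This is the product formula in the form that separates points. -/
theorem one_le_absNorm_mul_prod {I : Ideal (𝓞 K)} (hI : I ≠ ⊥) {x : K} (hx : x ≠ 0)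
    (h : ∀ r ∈ I, IsIntegral ℤ ((r : K) * x)) :
    1 ≤ (Ideal.absNorm I : ℝ) * ∏ σ : K →+* ℂ, ‖σ x‖ := by
  obtain ⟨y, m, hm, rfl⟩ := IsFractionRing.div_surjective (A := 𝓞 K) x
  have hm0 : (m : 𝓞 K) ≠ 0 := nonZeroDivisors.ne_zero hm
  have hmK : (m : K) ≠ 0 := by exact_mod_cast hm0
  have hy0 : y ≠ 0 := by
    rintro rfl
    simp at hx
  have hle : I * Ideal.span {y} ≤ Ideal.span {m} := by
    rw [Ideal.mul_le]
    intro r hr s hs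
    obtain ⟨t, rfl⟩ := Ideal.mem_span_singleton'.mp hs
    obtain ⟨z, hz'⟩ : ∃ z : 𝓞 K, (z : K) = r * (algebraMap (𝓞 K) K y / algebraMap (𝓞 K) K m) :=
      ⟨⟨_, h r hr⟩, rfl⟩
    have hz : (z : K) * m = r * y := by
      rw [hz', mul_assoc, div_mul_cancel₀ _ hmK]
    refine Ideal.mem_span_singleton'.mpr ⟨t * z, ?_⟩
    apply RingOfIntegers.coe_injective
    push_cast
    rw [mul_assoc, hz]
    ring
  have hdvd := Ideal.absNorm_dvd_absNorm_of_le hle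
  rw [map_mul] at hdvd
  have hpos : 0 < Ideal.absNorm I * Ideal.absNorm (Ideal.span {y}) := by
    apply Nat.pos_of_ne_zero
    simp [Ideal.absNorm_eq_zero_iff, hI, hy0]
  have hle2 := Nat.le_of_dvd hpos hdvd
  have hmpos : 0 < (Ideal.absNorm (Ideal.span {m}) : ℝ) := by
    exact_mod_cast Nat.pos_of_ne_zero (by simp [hm0])
  have : ∏ σ : K →+* ℂ, ‖σ (algebraMap (𝓞 K) K y / algebraMap (𝓞 K) K m)‖ =
      Ideal.absNorm (Ideal.span {y}) / Ideal.absNorm (Ideal.span {m}) := by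
    rw [← prod_norm_embeddings_int, ← prod_norm_embeddings_int, ← Finset.prod_div_distrib]
    simp
  rw [this, ← mul_div_assoc, le_div_iff₀ hmpos, one_mul]
  exact_mod_cast hle2

/-- Pigeonhole: cut the box into cells so small that the difference of two points in one cell would
violate `one_le_absNorm_mul_prod`. Then the points number at most the cells. -/
theorem card_box_le {I : Ideal (𝓞 K)} (hI : I ≠ ⊥) (B : (K →+* ℂ) → ℝ) (hB : ∀ σ, 0 < B σ)
    (hconj : ∀ σ, B (ComplexEmbedding.conjugate σ) = B σ)
    (hR : 1 ≤ (Ideal.absNorm I : ℝ) * ∏ σ, B σ) (F : Finset K)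
    (hF : ∀ x ∈ F, (∀ r ∈ I, IsIntegral ℤ ((r : K) * x)) ∧ ∀ σ : K →+* ℂ, ‖σ x‖ ≤ B σ) :
    (F.card : ℝ) ≤ 6 ^ Module.finrank ℚ K * ((Ideal.absNorm I : ℝ) * ∏ σ, B σ) := by
  classical
  set e := Module.finrank ℚ K with he
  set R := (Ideal.absNorm I : ℝ) * ∏ σ, B σ with hRdef
  have hcard : Fintype.card (K →+* ℂ) = e := Embeddings.card K ℂ
  have he0 : e ≠ 0 := Module.finrank_pos.ne'
  set ρ := R ^ ((e : ℝ)⁻¹) with hρ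
  have hρ1 : 1 ≤ ρ := Real.one_le_rpow hR (by positivity)
  have hρe : ρ ^ e = R := Real.rpow_inv_natCast_pow (by positivity) he0
  -- `M ≥ 4ρ` makes `(4/M)^e R ≤ 1`, and `M + 1 ≤ 4ρ + 2 ≤ 6ρ` because `ρ ≥ 1`.
  set M := ⌈4 * ρ⌉₊ with hM
  have hM1 : 4 * ρ ≤ M := Nat.le_ceil _
  have hM2 : (M : ℝ) < 4 * ρ + 1 := Nat.ceil_lt_add_one (by positivity)
  have hM0 : (0 : ℝ) < M := by linarith
  let ℓ : (K →+* ℂ) → K → ℝ := fun σ x => (σ x).re + (σ x).im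
  have hℓle : ∀ σ x, |ℓ σ x| ≤ 2 * ‖σ x‖ := fun σ x => by
    have h1 := Complex.abs_re_le_norm (σ x)
    have h2 := Complex.abs_im_le_norm (σ x)
    have h3 := abs_add_le (σ x).re (σ x).im
    linarith
  -- The interval `[-2B, 2B]` is cut into pieces of length `4B/M`; its right endpoint falls into a
  -- cell of its own, so there are `M + 1` cells.
  let cell : K → (K →+* ℂ) → ℕ := fun x σ => ⌊(ℓ σ x + 2 * B σ) * (M / (4 * B σ))⌋₊
  have hcell : ∀ x ∈ F, ∀ σ, 0 ≤ (ℓ σ x + 2 * B σ) * (M / (4 * B σ)) ∧ cell x σ < M + 1 := by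
    intro x hx σ
    have h1 := abs_le.mp ((hℓle σ x).trans (mul_le_mul_of_nonneg_left ((hF x hx).2 σ) zero_le_two))
    have hBσ := hB σ
    have hnn : 0 ≤ (ℓ σ x + 2 * B σ) * (M / (4 * B σ)) :=
      mul_nonneg (by linarith) (by positivity)
    refine ⟨hnn, ?_⟩
    rw [Nat.floor_lt hnn]
    have : (ℓ σ x + 2 * B σ) * (M / (4 * B σ)) ≤ (4 * B σ) * (M / (4 * B σ)) := by
      gcongr
      linarith
    rw [mul_div_cancel₀ _ (by positivity)] at this
    push_cast
    linarith
  have hinj : Set.InjOn cell F := by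
    intro x hx y hy hxy
    by_contra hne
    set z := x - y with hz
    have hz0 : z ≠ 0 := sub_ne_zero.mpr hne
    have hw : ∀ σ, |ℓ σ z| < 4 * B σ / M := by
      intro σ
      have h1 :
          |(ℓ σ x + 2 * B σ) * (M / (4 * B σ)) - (ℓ σ y + 2 * B σ) * (M / (4 * B σ))| < 1 := by
        have hc := congrFun hxy σ
        have a1 := Nat.floor_le (hcell x hx σ).1
        have a2 := Nat.lt_floor_add_one ((ℓ σ x + 2 * B σ) * (M / (4 * B σ)))
        have b1 := Nat.floor_le (hcell y hy σ).1
        have b2 := Nat.lt_floor_add_one ((ℓ σ y + 2 * B σ) * (M / (4 * B σ)))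
        have hc' : (⌊(ℓ σ x + 2 * B σ) * (M / (4 * B σ))⌋₊ : ℝ) =
          ⌊(ℓ σ y + 2 * B σ) * (M / (4 * B σ))⌋₊ := congrArg _ hc
        rw [abs_lt]
        constructor <;> linarith
      have hBσ := hB σ
      have h2 : (ℓ σ x + 2 * B σ) * (M / (4 * B σ)) - (ℓ σ y + 2 * B σ) * (M / (4 * B σ)) =
          ℓ σ z * (M / (4 * B σ)) := by
        simp only [ℓ, hz, map_sub, Complex.sub_re, Complex.sub_im]
        ring
      rw [h2, abs_mul, abs_of_pos (show 0 < (M : ℝ) / (4 * B σ) by positivity),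
        ← lt_div_iff₀ (by positivity), one_div_div] at h1
      exact h1
    have hnorm : ∀ σ : K →+* ℂ, ‖σ z‖ < 4 * B σ / M := by
      intro σ
      have hBσ := hB σ
      refine lt_of_pow_lt_pow_left₀ 2 (by positivity) ?_
      rw [norm_embedding_sq]
      have h1 := sq_lt_sq' (abs_lt.mp (hw σ)).1 (abs_lt.mp (hw σ)).2
      have h2' := hw (ComplexEmbedding.conjugate σ)
      rw [hconj] at h2'
      have h2 := sq_lt_sq' (abs_lt.mp h2').1 (abs_lt.mp h2').2
      simp only [ℓ] at h1 h2
      linarith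
    have hlow := one_le_absNorm_mul_prod hI hz0 (fun r hr => by
      rw [hz, mul_sub]
      exact ((hF x hx).1 r hr).sub ((hF y hy).1 r hr))
    have hNpos : (0 : ℝ) < Ideal.absNorm I := by
      exact_mod_cast Nat.pos_of_ne_zero (fun h => hI (Ideal.absNorm_eq_zero_iff.mp h))
    have hlt : ∏ σ : K →+* ℂ, ‖σ z‖ < ∏ σ : K →+* ℂ, (4 * B σ / M) :=
      Finset.prod_lt_prod_of_nonempty (fun σ _ => norm_pos_iff.mpr (by simpa using hz0))
        (fun σ _ => hnorm σ) Finset.univ_nonempty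
    have hprod : ∏ σ : K →+* ℂ, (4 * B σ / M) = (4 / M) ^ e * ∏ σ, B σ := by
      rw [← hcard, ← Finset.card_univ, ← Finset.prod_const, ← Finset.prod_mul_distrib]
      exact Finset.prod_congr rfl fun σ _ => by ring
    have hfin : (Ideal.absNorm I : ℝ) * ∏ σ : K →+* ℂ, (4 * B σ / M) ≤ 1 := by
      rw [hprod, mul_left_comm, ← hRdef, ← hρe, ← mul_pow]
      refine pow_le_one₀ (by positivity) ?_
      rw [div_mul_eq_mul_div]
      exact (div_le_one hM0).mpr hM1
    have := mul_lt_mul_of_pos_left hlt hNpos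
    linarith
  have hmaps : Set.MapsTo cell F (Fintype.piFinset fun _ : K →+* ℂ => Finset.range (M + 1)) := by
    intro x hx
    simp only [Finset.mem_coe, Fintype.mem_piFinset, Finset.mem_range]
    exact fun σ => (hcell x hx σ).2
  have hle := Finset.card_le_card_of_injOn cell hmaps hinj
  simp only [Fintype.card_piFinset, Finset.card_range, Finset.prod_const, Finset.card_univ,
    hcard] at hle
  calc (F.card : ℝ) ≤ ((M : ℝ) + 1) ^ e := by exact_mod_cast hle
    _ ≤ (6 * ρ) ^ e := by
      gcongr
      linarith
    _ = 6 ^ e * R := by rw [mul_pow, hρe]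

end Denominators

/-! ### A bound for the Dedekind zeta function at 2. -/

section IdealCount

open NumberField UniqueFactorizationMonoid

theorem prod_filter_fiber {α β : Type*} [Fintype β] [DecidableEq β] (f : α → ℕ) (idx : α → β)
    (s : Multiset α) :
    ∏ j, ((s.filter (fun a => idx a = j)).map f).prod = (s.map f).prod := by
  induction s using Multiset.induction_on with
  | empty => simp
  | cons a s ih =>
    simp only [Multiset.filter_cons, Multiset.map_add, Multiset.prod_add, Finset.prod_mul_distrib,
      ih, Multiset.map_cons, Multiset.prod_cons]
    congr 1
    rw [Finset.prod_eq_single (idx a)]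
    · simp
    · intro b _ hb
      simp [Ne.symm hb]
    · simp

variable {K : Type*} [Field K]

/-- The residue characteristic of a prime ideal. -/
noncomputable def residueChar (P : Ideal (𝓞 K)) : ℕ := Ideal.absNorm (Ideal.under ℤ P)

theorem residueChar_mem (P : Ideal (𝓞 K)) : (residueChar P : 𝓞 K) ∈ P := by
  have h := Int.absNorm_under_mem P
  exact h

theorem residueChar_prime {P : Ideal (𝓞 K)} (hP : P.IsPrime) (h0 : P ≠ ⊥) :
    (residueChar P).Prime := by
  have : NeZero P := ⟨h0⟩
  exact Nat.absNorm_under_prime P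

variable [NumberField K]

theorem absNorm_dvd_residueChar_pow (P : Ideal (𝓞 K)) :
    Ideal.absNorm P ∣ residueChar P ^ Module.finrank ℚ K := by
  rw [← RingOfIntegers.rank, ← Ideal.absNorm_span_natCast]
  exact Ideal.absNorm_dvd_absNorm_of_le
    ((Ideal.span_singleton_le_iff_mem _).mpr (residueChar_mem P))

theorem residueChar_dvd_absNorm {P : Ideal (𝓞 K)} (hP : P.IsPrime) (h0 : P ≠ ⊥) :
    residueChar P ∣ Ideal.absNorm P := by
  have h1 : Ideal.absNorm P ≠ 1 := by
    rw [Ne, Ideal.absNorm_eq_one_iff]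
    exact hP.ne_top
  obtain ⟨q, hq, hqd⟩ := Nat.exists_prime_and_dvd h1
  have h2 := hq.dvd_of_dvd_pow (hqd.trans (absNorm_dvd_residueChar_pow P))
  rwa [← (Nat.prime_dvd_prime_iff_eq hq (residueChar_prime hP h0)).mp h2]

/-- The product of distinct primes above `p` divides `(p)`, whose norm is `p^e`, while each of these
primes has norm divisible by `p`. -/
theorem ncard_residueChar_eq_le (p : ℕ) :
    {P : Ideal (𝓞 K) | P.IsPrime ∧ P ≠ ⊥ ∧ residueChar P = p}.Finite ∧
    {P : Ideal (𝓞 K) | P.IsPrime ∧ P ≠ ⊥ ∧ residueChar P = p}.ncard ≤ Module.finrank ℚ K := by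
  have key : ∀ F : Finset (Ideal (𝓞 K)),
      ↑F ⊆ {P : Ideal (𝓞 K) | P.IsPrime ∧ P ≠ ⊥ ∧ residueChar P = p} →
      (F.card : ℝ) ≤ Module.finrank ℚ K := by
    intro F hF
    rcases F.eq_empty_or_nonempty with rfl | ⟨Q, hQ⟩
    · simp
    have hp : p.Prime := by
      obtain ⟨h1, h2, h3⟩ := hF hQ
      exact h3 ▸ residueChar_prime h1 h2
    have hdvd : ∏ P ∈ F, P ∣ Ideal.span {(p : 𝓞 K)} := by
      refine Finset.prod_primes_dvd _ (fun P hP => ?_) (fun P hP => ?_)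
      · exact Ideal.prime_of_isPrime (hF hP).2.1 (hF hP).1
      · rw [Ideal.dvd_span_singleton, ← (hF hP).2.2]
        exact residueChar_mem P
    have h1 := Ideal.absNorm_dvd_absNorm_of_le (Ideal.le_of_dvd hdvd)
    rw [map_prod, Ideal.absNorm_span_natCast, RingOfIntegers.rank] at h1
    have h2 : p ^ F.card ∣ ∏ P ∈ F, Ideal.absNorm P := by
      rw [← Finset.prod_const]
      refine Finset.prod_dvd_prod_of_dvd _ _ fun P hP => ?_
      rw [← (hF hP).2.2]
      exact residueChar_dvd_absNorm (hF hP).1 (hF hP).2.1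
    exact_mod_cast (Nat.pow_dvd_pow_iff_le_right hp.one_lt).mp (h2.trans h1)
  have := finite_and_ncard_le key
  exact ⟨this.1, by exact_mod_cast this.2⟩

/-- Numbering the at most `e` primes above each rational prime sorts all primes into `e` classes in
which the residue characteristic determines the prime. -/
theorem exists_index_injOn : ∃ idx : Ideal (𝓞 K) → Fin (Module.finrank ℚ K),
    ∀ P Q : Ideal (𝓞 K), P.IsPrime → P ≠ ⊥ → Q.IsPrime → Q ≠ ⊥ →
      residueChar P = residueChar Q → idx P = idx Q → P = Q := by
  classical
  have h : ∀ p : ℕ, ∃ f : Ideal (𝓞 K) → Fin (Module.finrank ℚ K),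
      Set.InjOn f {P : Ideal (𝓞 K) | P.IsPrime ∧ P ≠ ⊥ ∧ residueChar P = p} := by
    intro p
    obtain ⟨hfin, hcard⟩ := ncard_residueChar_eq_le (K := K) p
    have : Nonempty (Fin (Module.finrank ℚ K)) := ⟨⟨0, Module.finrank_pos⟩⟩
    obtain ⟨f, -, hf⟩ := hfin.exists_injOn_of_encard_le
      (t := (Set.univ : Set (Fin (Module.finrank ℚ K)))) (by
      rw [← hfin.cast_ncard_eq]
      simpa using hcard)
    exact ⟨f, hf⟩
  choose f hf using h
  refine ⟨fun P => f (residueChar P) P, fun P Q hP hP0 hQ hQ0 hr hi => ?_⟩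
  refine hf (residueChar P) ⟨hP, hP0, rfl⟩ ⟨hQ, hQ0, hr.symm⟩ ?_
  simpa [hr] using hi

/-- Within one class, `P` alone contributes powers of its residue characteristic, so its
multiplicity can be read off from an integer. -/
theorem factorization_prod_absNorm [DecidableEq (Ideal (𝓞 K))]
    {idx : Ideal (𝓞 K) → Fin (Module.finrank ℚ K)}
    (hidx : ∀ P Q : Ideal (𝓞 K), P.IsPrime → P ≠ ⊥ → Q.IsPrime → Q ≠ ⊥ →
      residueChar P = residueChar Q → idx P = idx Q → P = Q)
    {P : Ideal (𝓞 K)} (hP : P.IsPrime) (hP0 : P ≠ ⊥) (s : Multiset (Ideal (𝓞 K)))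
    (hs : ∀ Q ∈ s, Q.IsPrime ∧ Q ≠ ⊥) :
    (((s.filter (fun Q => idx Q = idx P)).map Ideal.absNorm).prod).factorization (residueChar P) =
      s.count P * (Ideal.absNorm P).factorization (residueChar P) := by
  induction s using Multiset.induction_on with
  | empty => simp
  | cons Q s ih =>
    have hs' : ∀ R ∈ s, R.IsPrime ∧ R ≠ ⊥ := fun R hR => hs R (Multiset.mem_cons_of_mem hR)
    obtain ⟨hQ, hQ0⟩ := hs Q (Multiset.mem_cons_self Q s)
    specialize ih hs'
    by_cases hi : idx Q = idx P
    · have hne1 : Ideal.absNorm Q ≠ 0 := by simpa [Ideal.absNorm_eq_zero_iff] using hQ0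
      have hne2 : ((s.filter (fun Q => idx Q = idx P)).map Ideal.absNorm).prod ≠ 0 := by
        rw [Ne, Multiset.prod_eq_zero_iff]
        intro h
        obtain ⟨R, hR, hR0⟩ := Multiset.mem_map.mp h
        exact (hs' R (Multiset.mem_of_mem_filter hR)).2 (Ideal.absNorm_eq_zero_iff.mp hR0)
      rw [Multiset.filter_cons_of_pos (p := fun Q => idx Q = idx P) s hi, Multiset.map_cons,
        Multiset.prod_cons, Nat.factorization_mul hne1 hne2, Finsupp.add_apply, ih]
      by_cases hQP : Q = P
      · subst hQP
        rw [Multiset.count_cons_self]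
        ring
      · have h0 : (Ideal.absNorm Q).factorization (residueChar P) = 0 := by
          apply Nat.factorization_eq_zero_of_not_dvd
          intro hd
          have h2 := (residueChar_prime hP hP0).dvd_of_dvd_pow
            (hd.trans (absNorm_dvd_residueChar_pow Q))
          exact hQP (hidx Q P hQ hQ0 hP hP0 ((Nat.prime_dvd_prime_iff_eq (residueChar_prime hP hP0)
            (residueChar_prime hQ hQ0)).mp h2).symm hi)
        rw [h0, zero_add, Multiset.count_cons_of_ne (Ne.symm hQP)]
    · rw [Multiset.filter_cons_of_neg (p := fun Q => idx Q = idx P) s hi, ih,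
        Multiset.count_cons_of_ne]
      rintro rfl
      exact hi rfl

/-- Splitting the prime factors of an ideal by class and taking norms embeds the nonzero ideals into
`e`-tuples of positive integers whose product is the norm. The sum is thus bounded by `(∑ m⁻²)^e`,
and `∑ m⁻² ≤ 2`. -/
theorem sum_inv_sq_absNorm_le (T : Finset (Ideal (𝓞 K))) (hT : ∀ I ∈ T, I ≠ ⊥) :
    ∑ I ∈ T, ((Ideal.absNorm I : ℝ) ^ 2)⁻¹ ≤ 2 ^ Module.finrank ℚ K := by
  classical
  obtain ⟨idx, hidx⟩ := exists_index_injOn (K := K)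
  let g : Ideal (𝓞 K) → Fin (Module.finrank ℚ K) → ℕ := fun I j =>
    (((normalizedFactors I).filter (fun Q => idx Q = j)).map Ideal.absNorm).prod
  have hnf : ∀ I : Ideal (𝓞 K), I ≠ ⊥ →
      ∀ Q ∈ normalizedFactors I, Ideal.IsPrime Q ∧ Q ≠ ⊥ := fun I hI Q hQ =>
    ⟨((Ideal.mem_normalizedFactors_iff hI).mp hQ).1, ne_zero_of_mem_normalizedFactors hQ⟩
  have hprod : ∀ I ∈ T, ∏ j, g I j = Ideal.absNorm I := by
    intro I hI
    rw [prod_filter_fiber, ← map_multiset_prod, Ideal.prod_normalizedFactors_eq_self (hT I hI)]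
  have hpos : ∀ I ∈ T, ∀ j, 1 ≤ g I j := by
    intro I hI j
    by_contra h
    have h0 : g I j = 0 := by omega
    have := hprod I hI
    rw [Finset.prod_eq_zero (Finset.mem_univ j) h0] at this
    exact hT I hI (Ideal.absNorm_eq_zero_iff.mp this.symm)
  have hinj : Set.InjOn g T := by
    intro I hI J hJ hIJ
    rw [← Ideal.prod_normalizedFactors_eq_self (hT I hI),
      ← Ideal.prod_normalizedFactors_eq_self (hT J hJ)]
    congr 1
    ext P
    by_cases hP : P.IsPrime ∧ P ≠ ⊥
    · have h1 := factorization_prod_absNorm hidx hP.1 hP.2 _ (hnf I (hT I hI))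
      have h2 := factorization_prod_absNorm hidx hP.1 hP.2 _ (hnf J (hT J hJ))
      have h3 : (g I (idx P)).factorization (residueChar P) =
        (g J (idx P)).factorization (residueChar P) := by rw [hIJ]
      simp only [g] at h3
      rw [h1, h2] at h3
      refine Nat.eq_of_mul_eq_mul_right ?_ h3
      refine (residueChar_prime hP.1 hP.2).factorization_pos_of_dvd ?_
        (residueChar_dvd_absNorm hP.1 hP.2)
      simpa [Ideal.absNorm_eq_zero_iff] using hP.2
    · rw [Multiset.count_eq_zero_of_notMem fun h => hP (hnf I (hT I hI) P h),
        Multiset.count_eq_zero_of_notMem fun h => hP (hnf J (hT J hJ) P h)]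
  obtain ⟨N, hN⟩ : ∃ N : ℕ, ∀ I ∈ T, ∀ j, g I j < N := by
    refine ⟨(∑ I ∈ T, ∑ j, g I j) + 1, fun I hI j => Nat.lt_succ_of_le ?_⟩
    exact (Finset.single_le_sum (f := fun j => g I j) (fun _ _ => Nat.zero_le _)
      (Finset.mem_univ j)).trans
      (Finset.single_le_sum (f := fun I => ∑ j, g I j) (fun _ _ => Nat.zero_le _) hI)
  calc ∑ I ∈ T, ((Ideal.absNorm I : ℝ) ^ 2)⁻¹ = ∑ I ∈ T, ∏ j, ((g I j : ℝ) ^ 2)⁻¹ := by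
        refine Finset.sum_congr rfl fun I hI => ?_
        rw [← hprod I hI]
        push_cast
        rw [← Finset.prod_pow, Finset.prod_inv_distrib]
    _ = ∑ h ∈ T.image g, ∏ j, ((h j : ℝ) ^ 2)⁻¹ := by
        rw [Finset.sum_image hinj]
    _ ≤ ∑ h ∈ Fintype.piFinset (fun _ : Fin (Module.finrank ℚ K) => Finset.Ioo 0 N),
          ∏ j, ((h j : ℝ) ^ 2)⁻¹ := by
        refine Finset.sum_le_sum_of_subset_of_nonneg ?_ fun h _ _ =>
          Finset.prod_nonneg fun j _ => by positivity
        intro h hh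
        obtain ⟨I, hI, rfl⟩ := Finset.mem_image.mp hh
        simp only [Fintype.mem_piFinset, Finset.mem_Ioo]
        exact fun j => ⟨hpos I hI j, hN I hI j⟩
    _ = ∏ j : Fin (Module.finrank ℚ K), ∑ m ∈ Finset.Ioo 0 N, ((m : ℝ) ^ 2)⁻¹ := by
        rw [Finset.prod_univ_sum]
    _ ≤ ∏ j : Fin (Module.finrank ℚ K), (2 : ℝ) := by
        refine Finset.prod_le_prod (fun j _ => Finset.sum_nonneg fun m _ => by positivity)
          fun j _ => ?_
        simpa using sum_Ioo_inv_sq_le (α := ℝ) 0 N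
    _ = 2 ^ Module.finrank ℚ K := by simp

end IdealCount

/-! ### Relative heights of tuples and the number of completions of a partial tuple. -/

section TupleHeight

open NumberField

variable {K : Type*} [Field K]

/-- The archimedean local factor `max(1, ‖σ(c)‖)` of the height of a tuple. -/
noncomputable def archSize {ι : Type*} [Fintype ι] (c : ι → K) (σ : K →+* ℂ) : ℝ :=
  max 1 ‖fun i => σ (c i)‖

theorem one_le_archSize {ι : Type*} [Fintype ι] (c : ι → K) (σ : K →+* ℂ) : 1 ≤ archSize c σ :=
  le_max_left _ _

theorem archSize_pos {ι : Type*} [Fintype ι] (c : ι → K) (σ : K →+* ℂ) : 0 < archSize c σ :=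
  zero_lt_one.trans_le (one_le_archSize c σ)

theorem norm_le_archSize {ι : Type*} [Fintype ι] (c : ι → K) (σ : K →+* ℂ) (i : ι) :
    ‖σ (c i)‖ ≤ archSize c σ :=
  (norm_le_pi_norm (fun i => σ (c i)) i).trans (le_max_right _ _)

theorem archSize_le {ι : Type*} [Fintype ι] {c : ι → K} {σ : K →+* ℂ} {B : ℝ} (h1 : 1 ≤ B)
    (h : ∀ i, ‖σ (c i)‖ ≤ B) : archSize c σ ≤ B :=
  max_le h1 ((pi_norm_le_iff_of_nonneg (zero_le_one.trans h1)).mpr h)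

theorem archSize_conjugate {ι : Type*} [Fintype ι] (c : ι → K) (σ : K →+* ℂ) :
    archSize c (ComplexEmbedding.conjugate σ) = archSize c σ := by
  refine le_antisymm (archSize_le (one_le_archSize _ _) fun i => ?_)
    (archSize_le (one_le_archSize _ _) fun i => ?_)
  · rw [ComplexEmbedding.conjugate_coe_eq, Complex.norm_conj]
    exact norm_le_archSize c σ i
  · rw [← Complex.norm_conj, ← ComplexEmbedding.conjugate_coe_eq]
    exact norm_le_archSize c _ i

theorem archSize_comp_le {ι κ : Type*} [Fintype ι] [Fintype κ] (c : ι → K) (f : κ → ι)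
    (σ : K →+* ℂ) : archSize (c ∘ f) σ ≤ archSize c σ :=
  archSize_le (one_le_archSize _ _) fun i => norm_le_archSize c σ (f i)

variable [NumberField K]

/-- The height of the projective point `(1 : c)`, relative to the number field `K`. -/
noncomputable def tupleHeight {ι : Type*} [Fintype ι] (c : ι → K) : ℝ :=
  Ideal.absNorm (denomIdeal c) * ∏ σ : K →+* ℂ, archSize c σ

theorem one_le_tupleHeight {ι : Type*} [Fintype ι] (c : ι → K) : 1 ≤ tupleHeight c := by
  have h1 : (1 : ℝ) ≤ Ideal.absNorm (denomIdeal c) := by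
    exact_mod_cast absNorm_denomIdeal_pos c
  have h2 : 1 ≤ ∏ σ : K →+* ℂ, archSize c σ := Finset.one_le_prod fun σ _ => one_le_archSize c σ
  exact one_le_mul_of_one_le_of_one_le h1 h2

theorem tupleHeight_comp_le {ι κ : Type*} [Fintype ι] [Fintype κ] (c : ι → K) (f : κ → ι) :
    tupleHeight (c ∘ f) ≤ tupleHeight c := by
  refine mul_le_mul ?_ (Finset.prod_le_prod (fun σ _ => (archSize_pos _ _).le)
    fun σ _ => archSize_comp_le c f σ) (Finset.prod_nonneg fun σ _ => (archSize_pos _ _).le)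
    (Nat.cast_nonneg _)
  exact_mod_cast Nat.le_of_dvd (absNorm_denomIdeal_pos c)
    (Ideal.absNorm_dvd_absNorm_of_le (denomIdeal_le_comp c f))

theorem sum_piFinset_prod_geom_le {κ : Type*} [Fintype κ] [DecidableEq κ] (N : ℕ) :
    ∑ k ∈ Fintype.piFinset (fun _ : κ => Finset.range N), ∏ s, ((25 / 36 : ℝ)) ^ (k s) ≤
      4 ^ Fintype.card κ := by
  rw [← Finset.prod_univ_sum (fun _ : κ => Finset.range N) fun _ m => (25 / 36 : ℝ) ^ m]
  rw [Finset.prod_const, Finset.card_univ]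
  refine pow_le_pow_left₀ (Finset.sum_nonneg fun m _ => by positivity) ?_ _
  have h := Summable.sum_le_tsum (Finset.range N) (fun m _ => by positivity)
    (summable_geometric_of_lt_one (r := (25 / 36 : ℝ)) (by norm_num) (by norm_num))
  rw [tsum_geometric_of_lt_one (by norm_num) (by norm_num)] at h
  -- The geometric series with ratio `25/36` sums to `36/11 < 4`.
  norm_num at h ⊢
  linarith

/-- Rankin's trick with exponent 2: each admissible pair is counted with weight `(q / size)^2 ≥ 1`,
and the weighted sum factors into an ideal sum, at most `2^e`, and geometric series, at most `4^e`.
-/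
theorem card_weighted_pairs_le {q : ℝ} (P : Finset (Ideal (𝓞 K) × ((K →+* ℂ) → ℕ)))
    (h : ∀ p ∈ P, p.1 ≠ ⊥ ∧ (Ideal.absNorm p.1 : ℝ) * ∏ σ, (6 / 5 : ℝ) ^ p.2 σ ≤ q) :
    (P.card : ℝ) ≤ q ^ 2 * 8 ^ Module.finrank ℚ K := by
  classical
  set e := Module.finrank ℚ K with he
  have hcard : Fintype.card (K →+* ℂ) = e := Embeddings.card K ℂ
  obtain ⟨N, hN⟩ : ∃ N : ℕ, ∀ p ∈ P, ∀ σ, p.2 σ < N := by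
    refine ⟨(∑ p ∈ P, ∑ σ, p.2 σ) + 1, fun p hp σ => Nat.lt_succ_of_le ?_⟩
    exact (Finset.single_le_sum (f := fun σ => p.2 σ) (fun _ _ => Nat.zero_le _)
      (Finset.mem_univ σ)).trans
      (Finset.single_le_sum (f := fun p => ∑ σ, p.2 σ) (fun _ _ => Nat.zero_le _) hp)
  set T := P.image Prod.fst
  set L := Fintype.piFinset fun _ : K →+* ℂ => Finset.range N
  have hsub : P ⊆ T ×ˢ L := by
    intro p hp
    simp only [L, Finset.mem_product, Fintype.mem_piFinset, Finset.mem_range]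
    exact ⟨Finset.mem_image_of_mem _ hp, fun σ => hN p hp σ⟩
  have hT : ∑ I ∈ T, ((Ideal.absNorm I : ℝ) ^ 2)⁻¹ ≤ 2 ^ e :=
    sum_inv_sq_absNorm_le _ fun I hI => by
      obtain ⟨p, hp, rfl⟩ := Finset.mem_image.mp hI
      exact (h p hp).1
  have hkk := sum_piFinset_prod_geom_le (κ := K →+* ℂ) N
  rw [hcard] at hkk
  let w : Ideal (𝓞 K) → ℝ := fun I => ((Ideal.absNorm I : ℝ) ^ 2)⁻¹
  let v : ((K →+* ℂ) → ℕ) → ℝ := fun k => ∏ σ, (25 / 36 : ℝ) ^ k σ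
  have hw : ∀ I, 0 ≤ w I := fun I => by positivity
  have hv : ∀ k, 0 ≤ v k := fun k => Finset.prod_nonneg fun σ _ => by positivity
  have hone : ∀ p ∈ P, 1 ≤ q ^ 2 * (w p.1 * v p.2) := by
    intro p hp
    obtain ⟨hI, hq⟩ := h p hp
    have hNpos : (0 : ℝ) < Ideal.absNorm p.1 := by
      exact_mod_cast Nat.pos_of_ne_zero fun h => hI (Ideal.absNorm_eq_zero_iff.mp h)
    have hpos : 0 < (Ideal.absNorm p.1 : ℝ) * ∏ σ, (6 / 5 : ℝ) ^ p.2 σ :=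
      mul_pos hNpos (Finset.prod_pos fun σ _ => by positivity)
    have hvv : v p.2 = ((∏ σ, (6 / 5 : ℝ) ^ p.2 σ) ^ 2)⁻¹ := by
      rw [← Finset.prod_pow, ← Finset.prod_inv_distrib]
      refine Finset.prod_congr rfl fun σ _ => ?_
      rw [← pow_mul, mul_comm (p.2 σ), pow_mul, ← inv_pow]
      norm_num
    rw [hvv, ← mul_inv, ← mul_pow, ← div_eq_mul_inv, ← div_pow]
    exact one_le_pow₀ ((one_le_div hpos).mpr hq)
  have hTnn : 0 ≤ ∑ k ∈ L, v k := Finset.sum_nonneg fun k _ => hv k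
  calc (P.card : ℝ) = ∑ p ∈ P, (1 : ℝ) := by simp
    _ ≤ ∑ p ∈ P, q ^ 2 * (w p.1 * v p.2) := Finset.sum_le_sum hone
    _ ≤ ∑ p ∈ T ×ˢ L, q ^ 2 * (w p.1 * v p.2) :=
        Finset.sum_le_sum_of_subset_of_nonneg hsub fun p _ _ =>
          mul_nonneg (sq_nonneg q) (mul_nonneg (hw _) (hv _))
    _ = q ^ 2 * ((∑ I ∈ T, w I) * ∑ k ∈ L, v k) := by
        rw [← Finset.mul_sum, Finset.sum_product, Finset.sum_mul_sum]
    _ ≤ q ^ 2 * (2 ^ e * 4 ^ e) :=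
        mul_le_mul_of_nonneg_left (mul_le_mul hT hkk hTnn (by positivity)) (sq_nonneg q)
    _ = q ^ 2 * 8 ^ e := by
        rw [← mul_pow]
        norm_num

/-- Passing from `b` to `c` multiplies the denominator ideal by some `t` and the archimedean sizes
by factors at least 1, recorded up to a factor `6/5`. The total growth is at most `Z / H(b)`, which
bounds the number of types; for a fixed type, every free entry lies in one box of one fractional
ideal. -/
theorem card_tuples_le {ι : Type*} [Fintype ι] [DecidableEq ι] (S : Finset ι) (b : S → K) {Z : ℝ}
    (hZ : 0 ≤ Z) (F : Finset (ι → K)) (hF : ∀ c ∈ F, (∀ i : S, c i = b i) ∧ tupleHeight c ≤ Z) :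
    (F.card : ℝ) ≤ (Z / tupleHeight b) ^ 2 * 8 ^ Module.finrank ℚ K *
      (8 ^ Module.finrank ℚ K * Z) ^ (Fintype.card ι - S.card) := by
  classical
  set e := Module.finrank ℚ K with he
  have hcard : Fintype.card (K →+* ℂ) = e := Embeddings.card K ℂ
  have hb1 := one_le_tupleHeight b
  rcases F.eq_empty_or_nonempty with rfl | ⟨c₀, hc₀⟩
  · simp only [Finset.card_empty, Nat.cast_zero]
    positivity
  have hZ1 : 1 ≤ Z := (one_le_tupleHeight c₀).trans (hF c₀ hc₀).2
  have hcomp : ∀ c ∈ F, b = c ∘ (Subtype.val : S → ι) := fun c hc => by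
    ext i
    exact ((hF c hc).1 i).symm
  have hdvd : ∀ c ∈ F, denomIdeal b ∣ denomIdeal c := fun c hc => by
    rw [Ideal.dvd_iff_le, hcomp c hc]
    exact denomIdeal_le_comp c _
  obtain ⟨t, ht⟩ : ∃ t : (ι → K) → Ideal (𝓞 K), ∀ c ∈ F, denomIdeal c = denomIdeal b * t c := by
    choose! t ht using hdvd
    exact ⟨t, ht⟩
  obtain ⟨κ, hκ⟩ : ∃ κ : ℝ → ℕ, ∀ x : ℝ, 1 ≤ x →
      (6 / 5 : ℝ) ^ κ x ≤ x ∧ x < (6 / 5) ^ (κ x + 1) := by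
    choose! κ hκ using fun (x : ℝ) (hx : 1 ≤ x) =>
      exists_nat_pow_near hx (show (1 : ℝ) < 6 / 5 by norm_num)
    exact ⟨κ, hκ⟩
  let k : (ι → K) → (K →+* ℂ) → ℕ := fun c σ => κ (archSize c σ / archSize b σ)
  have hk : ∀ c ∈ F, ∀ σ, (6 / 5 : ℝ) ^ k c σ * archSize b σ ≤ archSize c σ ∧
      archSize c σ ≤ (6 / 5) ^ (k c σ + 1) * archSize b σ := by
    intro c hc σ
    have hpos := archSize_pos b σ
    have h1 : 1 ≤ archSize c σ / archSize b σ := by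
      rw [one_le_div hpos, hcomp c hc]
      exact archSize_comp_le c _ σ
    have h2 := hκ _ h1
    rw [le_div_iff₀ hpos, div_lt_iff₀ hpos] at h2
    exact ⟨h2.1, h2.2.le⟩
  have hheight : ∀ c ∈ F, tupleHeight b * (Ideal.absNorm (t c) * ∏ σ, (6 / 5 : ℝ) ^ k c σ) ≤ Z := by
    intro c hc
    refine le_trans ?_ (hF c hc).2
    unfold tupleHeight
    rw [ht c hc, map_mul]
    push_cast
    have : ∏ σ, ((6 / 5 : ℝ) ^ k c σ * archSize b σ) ≤ ∏ σ, archSize c σ :=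
      Finset.prod_le_prod (fun σ _ => mul_nonneg (by positivity) (archSize_pos b σ).le)
        fun σ _ => (hk c hc σ).1
    rw [Finset.prod_mul_distrib] at this
    calc _ = (Ideal.absNorm (denomIdeal b) : ℝ) * Ideal.absNorm (t c) *
          ((∏ σ, (6 / 5 : ℝ) ^ k c σ) * ∏ σ, archSize b σ) := by ring
      _ ≤ _ := by gcongr
  have ht0 : ∀ c ∈ F, t c ≠ ⊥ := by
    intro c hc h
    have := ht c hc
    rw [h, Ideal.mul_bot] at this
    exact denomIdeal_ne_bot c this
  have htpos : ∀ c ∈ F, (0 : ℝ) < Ideal.absNorm (t c) := fun c hc => by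
    exact_mod_cast Nat.pos_of_ne_zero fun h => ht0 c hc (Ideal.absNorm_eq_zero_iff.mp h)
  set W := (8 ^ e * Z) ^ (Fintype.card ι - S.card) with hW
  let key : (ι → K) → Ideal (𝓞 K) × ((K →+* ℂ) → ℕ) := fun c => (t c, k c)
  have hfiber : ∀ c ∈ F, ((F.filter (fun x => key x = key c)).card : ℝ) ≤ W := by
    intro c hc
    set G := F.filter (fun x => key x = key c) with hG
    have hGF : ∀ x ∈ G, x ∈ F ∧ t x = t c ∧ k x = k c := fun x hx => by
      obtain ⟨h1, h2⟩ := Finset.mem_filter.mp hx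
      exact ⟨h1, (Prod.ext_iff.mp h2).1, (Prod.ext_iff.mp h2).2⟩
    -- Rounding up costs `(6/5)^e`; together with the `6^e` of `card_box_le` this is `7.2^e ≤ 8^e`.
    let B : (K →+* ℂ) → ℝ := fun σ => (6 / 5) ^ (k c σ + 1) * archSize b σ
    have hB : ∀ σ, 0 < B σ := fun σ => mul_pos (by positivity) (archSize_pos b σ)
    have hBconj : ∀ σ, B (ComplexEmbedding.conjugate σ) = B σ := fun σ => by
      simp only [B, k, archSize_conjugate]
    have hR1 : 1 ≤ (Ideal.absNorm (denomIdeal c) : ℝ) * ∏ σ, B σ := by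
      refine (one_le_tupleHeight c).trans ?_
      unfold tupleHeight
      gcongr with σ
      · exact fun σ _ => (archSize_pos c σ).le
      · exact (hk c hc σ).2
    have hR2 : (Ideal.absNorm (denomIdeal c) : ℝ) * ∏ σ, B σ ≤ (6 / 5) ^ e * Z := by
      have h1 : ∏ σ, B σ = (6 / 5) ^ e * ((∏ σ, (6 / 5 : ℝ) ^ k c σ) * ∏ σ, archSize b σ) := by
        rw [← hcard, ← Finset.card_univ, ← Finset.prod_const, ← Finset.prod_mul_distrib,
          ← Finset.prod_mul_distrib]
        exact Finset.prod_congr rfl fun σ _ => by simp only [B]; ring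
      have h2 := hheight c hc
      unfold tupleHeight at h2
      rw [h1, ht c hc, map_mul]
      push_cast
      calc _ = (6 / 5 : ℝ) ^ e * ((Ideal.absNorm (denomIdeal b)) * (∏ σ, archSize b σ) *
            ((Ideal.absNorm (t c)) * ∏ σ, (6 / 5 : ℝ) ^ k c σ)) := by ring
        _ ≤ _ := by gcongr
    have hcoord : ∀ i : ι, ((G.image (fun x => x i)).card : ℝ) ≤ 8 ^ e * Z := by
      intro i
      have := card_box_le (denomIdeal_ne_bot c) B hB hBconj hR1 (G.image (fun x => x i)) (by
        intro y hy
        obtain ⟨x, hx, rfl⟩ := Finset.mem_image.mp hy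
        obtain ⟨hxF, hxt, hxk⟩ := hGF x hx
        refine ⟨fun r hr => ?_, fun σ => ?_⟩
        · have : denomIdeal x = denomIdeal c := by rw [ht x hxF, ht c hc, hxt]
          rw [← this] at hr
          exact hr i
        · refine (norm_le_archSize x σ i).trans ((hk x hxF σ).2.trans ?_)
          rw [hxk])
      refine this.trans ?_
      calc _ ≤ (6 : ℝ) ^ e * ((6 / 5) ^ e * Z) := by gcongr
        _ = (6 * (6 / 5)) ^ e * Z := by rw [mul_pow]; ring
        _ ≤ 8 ^ e * Z := by
          gcongr
          norm_num
    have hle : G.card ≤ ∏ i : {i // i ∉ S}, (G.image (fun x => x i)).card := by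
      rw [← Fintype.card_piFinset]
      refine Finset.card_le_card_of_injOn (fun x i => x i) (fun x hx => ?_) ?_
      · simp only [Finset.mem_coe, Fintype.mem_piFinset]
        exact fun i => Finset.mem_image_of_mem _ hx
      · intro x hx y hy hxy
        ext i
        by_cases hi : i ∈ S
        · rw [(hF x (hGF x hx).1).1 ⟨i, hi⟩, (hF y (hGF y hy).1).1 ⟨i, hi⟩]
        · exact congrFun hxy ⟨i, hi⟩
    calc (G.card : ℝ) ≤ ∏ i : {i // i ∉ S}, ((G.image (fun x => x i)).card : ℝ) := by
          exact_mod_cast hle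
      _ ≤ ∏ i : {i // i ∉ S}, (8 ^ e * Z) :=
          Finset.prod_le_prod (fun i _ => Nat.cast_nonneg _) fun i _ => hcoord i
      _ = W := by
          rw [Finset.prod_const, Finset.card_univ, Fintype.card_subtype_compl,
            Fintype.card_coe]
  have h1 := card_le_sum_image F key (fun _ => W) hfiber
  rw [Finset.sum_const, nsmul_eq_mul] at h1
  have h2 : ((F.image key).card : ℝ) ≤ (Z / tupleHeight b) ^ 2 * 8 ^ e := by
    refine card_weighted_pairs_le _ fun p hp => ?_
    obtain ⟨c, hc, rfl⟩ := Finset.mem_image.mp hp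
    refine ⟨ht0 c hc, ?_⟩
    rw [le_div_iff₀ (by linarith), mul_comm]
    exact hheight c hc
  calc (F.card : ℝ) ≤ (F.image key).card * W := h1
    _ ≤ _ := by gcongr

end TupleHeight

/-! ### Products over embeddings. -/

section Embeddings

open NumberField

/-- Embeddings of `L` are grouped by their restriction to `K(α)`. The restrictions run through the
distinct conjugates of `α`, and each extends in `[L : K(α)]` ways. -/
theorem prod_X_sub_C_embeddings {K L Ω : Type*} [Field K] [CharZero K] [Field L] [Algebra K L]
    [FiniteDimensional K L] [Field Ω] [IsAlgClosed Ω] [Algebra K Ω] (α : L) :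
    ∏ τ : L →ₐ[K] Ω, (X - C (τ α)) =
      ((minpoly K α).map (algebraMap K Ω)) ^ Module.finrank K⟮α⟯ L := by
  have hα : IsIntegral K α := Algebra.IsIntegral.isIntegral α
  let pb := adjoin.powerBasis hα
  let : Fintype (K⟮α⟯ →ₐ[K] Ω) := PowerBasis.AlgHom.fintype pb
  have hgen : algebraMap K⟮α⟯ L pb.gen = α := by
    simp [pb, adjoin.powerBasis_gen]
  have hmin : minpoly K pb.gen = minpoly K α := by
    have h := minpoly.algebraMap_eq (A := K) (algebraMap K⟮α⟯ L).injective pb.gen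
    rw [hgen] at h
    exact h.symm
  have h1 : ∏ σ : K⟮α⟯ →ₐ[K] Ω, (X - C (σ pb.gen)) = (minpoly K α).map (algebraMap K Ω) := by
    classical
    rw [← hmin,
      (IsAlgClosed.splits ((minpoly K pb.gen).map (algebraMap K Ω))).eq_prod_roots_of_monic
      ((minpoly.monic pb.isIntegral_gen).map _)]
    rw [@Fintype.prod_equiv (K⟮α⟯ →ₐ[K] Ω) _ _ (PowerBasis.AlgHom.fintype pb) _ _ pb.liftEquiv'
      (fun σ => X - C (σ pb.gen)) (fun x => X - C (x : Ω)) ?_]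
    · rw [Finset.prod_mem_multiset _ _ (fun x => X - C x), Finset.prod_eq_multiset_prod,
        Multiset.toFinset_val, Multiset.dedup_eq_self.mpr]
      · exact nodup_roots (Polynomial.Separable.map (Algebra.IsSeparable.isSeparable K pb.gen))
      · intro x; rfl
    · intro σ; simp only [PowerBasis.liftEquiv'_apply_coe]
  rw [Fintype.prod_equiv algHomEquivSigma (fun σ : L →ₐ[K] Ω => _)
    (fun σ => X - C (σ.1 pb.gen)), ← Finset.univ_sigma_univ, Finset.prod_sigma, ← h1,
    ← Finset.prod_pow]
  · refine Finset.prod_congr rfl fun σ _ => ?_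
    let : Algebra K⟮α⟯ Ω := σ.toRingHom.toAlgebra
    simp_rw [Finset.prod_const]
    congr
    exact AlgHom.card K⟮α⟯ L Ω
  · intro σ
    conv_lhs => rw [← hgen]
    simp only [algHomEquivSigma, Equiv.coe_fn_mk, AlgHom.domRestrict, AlgHom.comp_apply,
      IsScalarTower.coe_toAlgHom']

/-- Multiplying `∏ (X - τ α)` by the norm of `r` gives `∏ (τ r X - τ (r α))`, whose factors have
integral coefficients. -/
theorem isIntegral_norm_mul_coeff {K L : Type*} [Field K] [CharZero K] [Field L] [Algebra K L]
    [FiniteDimensional K L] {α r : L} (hr : IsIntegral ℤ r) (hrα : IsIntegral ℤ (r * α)) (i : ℕ) :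
    IsIntegral ℤ (Algebra.norm K r * ((minpoly K α) ^ Module.finrank K⟮α⟯ L).coeff i) := by
  rw [← isIntegral_algebraMap_iff (algebraMap K (AlgebraicClosure K)).injective, map_mul,
    Algebra.norm_eq_prod_embeddings K (AlgebraicClosure K), ← coeff_map, Polynomial.map_pow,
    ← prod_X_sub_C_embeddings, ← coeff_C_mul, map_prod, ← Finset.prod_mul_distrib]
  refine Polynomial.isIntegral_coeff_prod _ _ (fun τ _ j => ?_) i
  have h1 : C (τ r) * (X - C (τ α)) = C (τ r) * X - C (τ (r * α)) := by
    rw [map_mul, C_mul]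
    ring
  rw [h1, coeff_sub, coeff_C_mul, coeff_X, coeff_C]
  have hτ : ∀ x : L, IsIntegral ℤ x → IsIntegral ℤ (τ x) := fun x hx =>
    hx.map (τ.restrictScalars ℤ)
  refine IsIntegral.sub ?_ ?_
  · split_ifs
    · simpa using hτ r hr
    · simpa using isIntegral_zero
  · split_ifs
    · exact hτ _ hrα
    · exact isIntegral_zero

theorem mahlerMeasure_prod_X_sub_C {ι : Type*} (s : Finset ι) (z : ι → ℂ) :
    (∏ j ∈ s, (X - C (z j))).mahlerMeasure = ∏ j ∈ s, max 1 ‖z j‖ := by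
  classical
  induction s using Finset.induction_on with
  | empty => simp
  | insert a s ha ih => rw [Finset.prod_insert ha, Finset.prod_insert ha, mahlerMeasure_mul, ih,
      mahlerMeasure_X_sub_C]

end Embeddings

/-! ### Tuple height, Mahler measure and Weil height. -/

section HeightComparison

open NumberField

variable {K : Type*} [Field K] [NumberField K]

theorem prod_ringHom_eq_prod_algHom {M : Type*} [CommMonoid M] (f : (K →+* ℂ) → M) :
    ∏ σ : K →+* ℂ, f σ = ∏ σ : K →ₐ[ℚ] ℂ, f σ :=
  Fintype.prod_equiv (RingHom.equivRatAlgHom K ℂ) _ _ (fun _ => rfl)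

/-- For a denominator `r` of `b`, the norm of `r` times the `m`-th power of the monic minimal
polynomial is an integer polynomial. As `D ^ m` is primitive by Gauss's lemma, the leading
coefficient to the power `m` divides that norm, and such norms span the relative norm of the
denominator ideal. -/
theorem leadingCoeff_pow_dvd_absNorm {b : K} {D : ℤ[X]} (hD : D.IsPrimitive)
    (hDm : D.map (Int.castRingHom ℚ) = C (D.leadingCoeff : ℚ) * minpoly ℚ b) :
    D.leadingCoeff ^ Module.finrank ℚ⟮b⟯ K ∣
      (Ideal.absNorm (denomIdeal fun _ : Unit => b) : ℤ) := by
  set m := Module.finrank ℚ⟮b⟯ K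
  rw [← Ideal.mem_span_singleton]
  suffices h : Ideal.relNorm ℤ (denomIdeal fun _ : Unit => b) ≤
      Ideal.span {D.leadingCoeff ^ m} by
    rw [Ideal.relNorm_int] at h
    exact h (Ideal.mem_span_singleton_self _)
  rw [Ideal.relNorm_apply, Ideal.span_le]
  rintro _ ⟨r, hr, rfl⟩
  rw [Algebra.intNorm_eq_norm, SetLike.mem_coe, Ideal.mem_span_singleton]
  set N := Algebra.norm ℤ r with hN
  have hNQ : (N : ℚ) = Algebra.norm ℚ (r : K) := Algebra.coe_norm_int r
  obtain ⟨P, hP⟩ : ∃ P : ℤ[X], P.map (Int.castRingHom ℚ) = C (N : ℚ) * minpoly ℚ b ^ m := by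
    have h : C (N : ℚ) * minpoly ℚ b ^ m ∈ lifts (Int.castRingHom ℚ) := by
      rw [lifts_iff_coeff_lifts]
      intro i
      rw [coeff_C_mul, hNQ]
      have := isIntegral_norm_mul_coeff (K := ℚ) r.isIntegral_coe (hr ()) i
      obtain ⟨z, hz⟩ := IsIntegrallyClosed.isIntegral_iff.mp this
      exact ⟨z, hz⟩
    exact h
  have hinj : Function.Injective (Int.castRingHom ℚ) := Int.cast_injective
  have key : C (D.leadingCoeff ^ m) * P = C N * D ^ m := by
    apply map_injective _ hinj
    rw [Polynomial.map_mul, Polynomial.map_mul, hP, Polynomial.map_pow, hDm, map_C, map_C, mul_pow]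
    simp only [eq_intCast, map_pow]
    ring
  have hpow : (D ^ m).IsPrimitive := by
    induction m with
    | zero => simp
    | succ k ih => exact pow_succ D k ▸ ih.mul hD
  have hcont := congrArg content key
  rw [content_C_mul, content_C_mul, hpow.content_eq_one, mul_one] at hcont
  have h1 : D.leadingCoeff ^ m ∣ normalize N := by
    rw [← hcont]
    exact (associated_normalize _).dvd.mul_right _
  exact h1.trans (normalize_associated N).dvd

theorem mahlerMeasure_pow_le_tupleHeight {b : K} {D : ℤ[X]} (hD : D.IsPrimitive)
    (hDm : D.map (Int.castRingHom ℚ) = C (D.leadingCoeff : ℚ) * minpoly ℚ b) :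
    (D.map (Int.castRingHom ℂ)).mahlerMeasure ^ Module.finrank ℚ⟮b⟯ K ≤
      tupleHeight fun _ : Unit => b := by
  set m := Module.finrank ℚ⟮b⟯ K
  have h1 : (D.map (Int.castRingHom ℂ)) ^ m =
      C ((D.leadingCoeff : ℂ) ^ m) * ∏ σ : K →ₐ[ℚ] ℂ, (X - C (σ b)) := by
    rw [prod_X_sub_C_embeddings, C_pow, ← mul_pow]
    congr 1
    have : Int.castRingHom ℂ = (algebraMap ℚ ℂ).comp (Int.castRingHom ℚ) := RingHom.ext_int _ _
    rw [this, ← Polynomial.map_map, hDm, Polynomial.map_mul, map_C]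
    simp
  have hpow : ∀ k : ℕ, ((D.map (Int.castRingHom ℂ)) ^ k).mahlerMeasure =
      (D.map (Int.castRingHom ℂ)).mahlerMeasure ^ k := by
    intro k
    induction k with
    | zero => simp
    | succ k ih => rw [pow_succ, mahlerMeasure_mul, ih, pow_succ]
  rw [← hpow, h1, mahlerMeasure_mul, mahlerMeasure_const, mahlerMeasure_prod_X_sub_C,
    show ∏ σ : K →ₐ[ℚ] ℂ, max 1 ‖σ b‖ = ∏ σ : K →+* ℂ, max 1 ‖σ b‖ from
      (prod_ringHom_eq_prod_algHom (fun σ : K →+* ℂ => max 1 ‖σ b‖)).symm]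
  unfold tupleHeight
  refine mul_le_mul ?_ (Finset.prod_le_prod (fun _ _ => by positivity) fun σ _ =>
    max_le (one_le_archSize _ _) (norm_le_archSize (fun _ : Unit => b) σ ()))
    (Finset.prod_nonneg fun _ _ => by positivity) (Nat.cast_nonneg _)
  have h2 := Int.natAbs_dvd_natAbs.mpr (leadingCoeff_pow_dvd_absNorm hD hDm)
  have h3 := Nat.le_of_dvd (by simpa using absNorm_denomIdeal_pos _) h2
  rw [← Int.cast_pow, Complex.norm_intCast, ← Int.cast_abs, Int.abs_eq_natAbs, Int.cast_natCast]
  exact_mod_cast h3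

/-- The norm to `K` of a denominator of `α` clears the denominators of all coefficients, so the
relative norm of the ideal for `α` lies in the ideal for the coefficients. -/
theorem absNorm_denomIdeal_minpoly_le {L : Type*} [Field L] [NumberField L] [Algebra K L] {α : L}
    (hα : K⟮α⟯ = ⊤) {ι : Type*} [Finite ι] (f : ι → ℕ) :
    Ideal.absNorm (denomIdeal fun i => (minpoly K α).coeff (f i)) ≤
      Ideal.absNorm (denomIdeal fun _ : Unit => α) := by
  have : FiniteDimensional K L := Module.Finite.of_restrictScalars_finite ℚ K L
  rw [← Ideal.absNorm_relNorm (R := 𝓞 K) (I := denomIdeal fun _ : Unit => α)]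
  refine Nat.le_of_dvd ?_ (Ideal.absNorm_dvd_absNorm_of_le ?_)
  · rw [Ideal.absNorm_relNorm]
    exact absNorm_denomIdeal_pos _
  · rw [Ideal.relNorm_apply, Ideal.span_le]
    rintro _ ⟨r, hr, rfl⟩ i
    have h1 : ((Algebra.intNorm (𝓞 K) (𝓞 L) r : 𝓞 K) : K) = Algebra.norm K (r : L) :=
      Algebra.algebraMap_intNorm (A := 𝓞 K) (K := K) (L := L) (B := 𝓞 L) r
    have h2 := isIntegral_norm_mul_coeff (K := K) r.isIntegral_coe (hr ()) (f i)
    rwa [hα, IntermediateField.finrank_top, pow_one, ← h1] at h2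

/-- At each embedding of `K`, coefficients are at most `2^n` times the Mahler measure, and these
Mahler measures multiply to the archimedean part of the height of `α`. The finite part does not
grow. -/
theorem tupleHeight_minpoly_le {L : Type*} [Field L] [NumberField L] [Algebra K L] {α : L}
    (hα : K⟮α⟯ = ⊤) {n : ℕ} (hn : (minpoly K α).natDegree = n) :
    tupleHeight (fun i : Fin n => (minpoly K α).coeff i) ≤
      2 ^ (n * Module.finrank ℚ K) * tupleHeight fun _ : Unit => α := by
  have : FiniteDimensional K L := Module.Finite.of_restrictScalars_finite ℚ K L
  have hm : (minpoly K α).Monic := minpoly.monic (Algebra.IsIntegral.isIntegral α)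
  have harch : ∏ σ : K →+* ℂ, archSize (fun i : Fin n => (minpoly K α).coeff i) σ ≤
      2 ^ (n * Module.finrank ℚ K) * ∏ τ : L →+* ℂ, archSize (fun _ : Unit => α) τ := by
    have h1 : ∏ τ : L →ₐ[ℚ] ℂ, max 1 ‖τ α‖ = ∏ σ : K →ₐ[ℚ] ℂ,
        ((minpoly K α).map (σ : K →+* ℂ)).mahlerMeasure := by
      rw [Fintype.prod_equiv (algHomEquivSigma (B := K)) (fun τ : L →ₐ[ℚ] ℂ => _)
        (fun τ => max 1 ‖τ.2 α‖), ← Finset.univ_sigma_univ, Finset.prod_sigma]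
      · refine Finset.prod_congr rfl fun σ _ => ?_
        let : Algebra K ℂ := σ.toRingHom.toAlgebra
        have h2 := prod_X_sub_C_embeddings (K := K) (Ω := ℂ) α
        rw [hα, IntermediateField.finrank_top, pow_one] at h2
        rw [← mahlerMeasure_prod_X_sub_C]
        exact congrArg mahlerMeasure h2
      · intro τ
        rfl
    have h3 : ∏ τ : L →ₐ[ℚ] ℂ, max 1 ‖τ α‖ ≤
        ∏ τ : L →+* ℂ, archSize (fun _ : Unit => α) τ := by
      refine (prod_ringHom_eq_prod_algHom (fun τ : L →+* ℂ => max 1 ‖τ α‖)).symm.trans_le ?_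
      exact Finset.prod_le_prod (fun _ _ => by positivity) fun τ _ =>
        max_le (one_le_archSize _ _) (norm_le_archSize (fun _ : Unit => α) τ ())
    refine le_trans ?_ (mul_le_mul_of_nonneg_left h3 (by positivity))
    rw [h1, ← prod_ringHom_eq_prod_algHom
      (fun σ : K →+* ℂ => ((minpoly K α).map σ).mahlerMeasure), pow_mul,
      ← Embeddings.card K ℂ, ← Finset.card_univ, ← Finset.prod_const, ← Finset.prod_mul_distrib]
    refine Finset.prod_le_prod (fun σ _ => (archSize_pos _ _).le) fun σ _ => ?_
    have hmσ : ((minpoly K α).map σ).Monic := hm.map σ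
    have hM1 : 1 ≤ ((minpoly K α).map σ).mahlerMeasure :=
      one_le_mahlerMeasure_of_one_le_norm_leadingCoeff (by rw [hmσ.leadingCoeff]; simp)
    refine archSize_le (one_le_mul_of_one_le_of_one_le (one_le_pow₀ one_le_two) hM1) fun i => ?_
    have h4 := norm_coeff_le_choose_mul_mahlerMeasure i ((minpoly K α).map σ)
    rw [coeff_map, hm.natDegree_map, hn] at h4
    refine h4.trans ?_
    gcongr
    exact_mod_cast Nat.choose_le_two_pow n i
  unfold tupleHeight
  calc _ ≤ (Ideal.absNorm (denomIdeal fun _ : Unit => α) : ℝ) *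
        (2 ^ (n * Module.finrank ℚ K) * ∏ τ : L →+* ℂ, archSize (fun _ : Unit => α) τ) := by
        refine mul_le_mul ?_ harch (Finset.prod_nonneg fun σ _ => (archSize_pos _ _).le)
          (Nat.cast_nonneg _)
        exact_mod_cast absNorm_denomIdeal_minpoly_le hα fun i : Fin n => (i : ℕ)
    _ = _ := by ring

theorem prod_infinitePlace_eq {f : InfinitePlace K → ℝ} :
    ∏ v : InfinitePlace K, f v ^ v.mult = ∏ σ : K →+* ℂ, f (InfinitePlace.mk σ) := by
  classical
  rw [← Finset.prod_fiberwise Finset.univ InfinitePlace.mk (fun σ => f (InfinitePlace.mk σ))]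
  refine Finset.prod_congr rfl fun w _ => ?_
  rw [Finset.prod_congr rfl fun φ hφ => by rw [(Finset.mem_filter.mp hφ).2], Finset.prod_const,
    InfinitePlace.card_filter_mk_eq]

/-- The denominator ideal of `y/m` is the quotient `(m) / (y, m)`, which exists since containing is
dividing. It turns the finite part of the Weil height into an ideal norm. -/
theorem denomIdeal_div_mul_span {y m : 𝓞 K} (hm : m ≠ 0) :
    denomIdeal (fun _ : Unit => (y : K) / m) * Ideal.span {y, m} = Ideal.span {m} := by
  have hmK : (m : K) ≠ 0 := by exact_mod_cast hm
  have hbot : Ideal.span {y, m} ≠ ⊥ := by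
    intro h
    have : m ∈ Ideal.span {y, m} := Ideal.subset_span (by simp)
    rw [h] at this
    exact hm (by simpa using this)
  obtain ⟨J, hJ⟩ : Ideal.span {y, m} ∣ Ideal.span {m} := by
    rw [Ideal.dvd_iff_le, Ideal.span_singleton_le_iff_mem]
    exact Ideal.subset_span (by simp)
  have hmem : ∀ r : 𝓞 K, r * y ∈ Ideal.span {m} ↔
      r ∈ denomIdeal (fun _ : Unit => (y : K) / m) := by
    intro r
    rw [Ideal.mem_span_singleton']
    constructor
    · rintro ⟨z, hz⟩ -
      have h1 : (z : K) * m = r * y := by exact_mod_cast congrArg (algebraMap (𝓞 K) K) hz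
      have h2 : (r : K) * ((y : K) / m) = z := by
        rw [← mul_div_assoc, ← h1, mul_div_cancel_right₀ _ hmK]
      rw [h2]
      exact z.isIntegral_coe
    · intro hr
      obtain ⟨z, hz⟩ : ∃ z : 𝓞 K, (z : K) = r * ((y : K) / m) := ⟨⟨_, hr ()⟩, rfl⟩
      have h1 : (z : K) * m = r * y := by rw [hz, mul_assoc, div_mul_cancel₀ _ hmK]
      refine ⟨z, RingOfIntegers.coe_injective ?_⟩
      push_cast
      exact h1
  have hle : Ideal.span {y, m} * denomIdeal (fun _ : Unit => (y : K) / m) ≤ Ideal.span {m} := by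
    rw [Ideal.mul_le]
    intro s hs r hr
    obtain ⟨a, b, rfl⟩ := Ideal.mem_span_pair.mp hs
    have h1 := (hmem r).mpr hr
    have h2 : m ∈ Ideal.span {m} := Ideal.mem_span_singleton_self m
    have : (a * y + b * m) * r = a * (r * y) + (b * r) * m := by ring
    rw [this]
    exact Ideal.add_mem _ (Ideal.mul_mem_left _ _ h1) (Ideal.mul_mem_left _ _ h2)
  have hJle : J ≤ denomIdeal (fun _ : Unit => (y : K) / m) := by
    intro r hr
    rw [← hmem, hJ, mul_comm r]
    exact Ideal.mul_mem_mul (Ideal.subset_span (by simp)) hr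
  rw [mul_comm]
  refine le_antisymm hle ?_
  rw [hJ]
  exact Ideal.mul_mono_right hJle

theorem mulHeight₁_eq_tupleHeight (x : K) :
    Height.mulHeight₁ x = tupleHeight fun _ : Unit => x := by
  obtain ⟨y, m, hm, rfl⟩ := IsFractionRing.div_surjective (A := 𝓞 K) x
  have hm0 : (m : 𝓞 K) ≠ 0 := nonZeroDivisors.ne_zero hm
  have hmK : (m : K) ≠ 0 := by exact_mod_cast hm0
  have hne : (![y, m] : Fin 2 → 𝓞 K) ≠ 0 := fun h => hm0 (by simpa using congrFun h 1)
  have hcoe : (![(y : K), (m : K)] : Fin 2 → K) = fun i => ((![y, m] i : 𝓞 K) : K) := by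
    ext i
    fin_cases i <;> rfl
  have hne' : (fun i => ((![y, m] i : 𝓞 K) : K)) ≠ 0 := fun h => hmK (by simpa using congrFun h 1)
  rw [Height.mulHeight₁_div_eq_mulHeight, hcoe, NumberField.mulHeight_eq hne']
  have hfin := absNorm_mul_finprod_finitePlace_eq_one hne
  have hrange : Set.range ![y, m] = {y, m} := by
    simp [Matrix.range_cons, Set.pair_comm]
  rw [hrange] at hfin
  have hmul := congrArg Ideal.absNorm (denomIdeal_div_mul_span (y := y) hm0)
  rw [map_mul] at hmul
  have harch : ∏ v : InfinitePlace K, (⨆ i, v ((![y, m] i : 𝓞 K) : K)) ^ v.mult =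
      (Ideal.absNorm (Ideal.span {m}) : ℝ) *
        ∏ σ : K →+* ℂ, archSize (fun _ : Unit => (y : K) / m) σ := by
    rw [prod_infinitePlace_eq (f := fun v => ⨆ i, v ((![y, m] i : 𝓞 K) : K)),
      ← prod_norm_embeddings_int, ← Finset.prod_mul_distrib]
    refine Finset.prod_congr rfl fun σ _ => ?_
    have h1 : (⨆ i, InfinitePlace.mk σ ((![y, m] i : 𝓞 K) : K)) = max ‖σ y‖ ‖σ m‖ := by
      refine le_antisymm (ciSup_le fun i => ?_) (max_le ?_ ?_)
      · fin_cases i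
        · exact le_max_left _ _
        · exact le_max_right _ _
      · exact Finite.le_ciSup_of_le 0 le_rfl
      · exact Finite.le_ciSup_of_le 1 le_rfl
    have h2 : archSize (fun _ : Unit => (y : K) / m) σ = max 1 ‖σ ((y : K) / m)‖ := by
      unfold archSize
      congr 1
      simp
    have h3 : 0 < ‖σ (m : K)‖ := by simpa using hmK
    rw [h1, h2, mul_max_of_nonneg _ _ h3.le, mul_one, map_div₀, norm_div,
      mul_div_cancel₀ _ h3.ne', max_comm]
  rw [harch]
  unfold tupleHeight
  rw [← hmul]
  push_cast
  calc _ = (Ideal.absNorm (denomIdeal fun _ : Unit => (y : K) / m) : ℝ) *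
        (∏ σ : K →+* ℂ, archSize (fun _ : Unit => (y : K) / m) σ) *
        (Ideal.absNorm (Ideal.span {y, m}) *
          ∏ᶠ v : FinitePlace K, ⨆ i, v ((![y, m] i : 𝓞 K) : K)) := by ring
    _ = _ := by rw [hfin, mul_one]

end HeightComparison

/-! ### Counting algebraic numbers of bounded Mahler measure. -/

section AlgebraicNumbers

open NumberField

instance numberField_adjoin_simple (α : Qbar) : NumberField ℚ⟮α⟯ where
  to_finiteDimensional := adjoin.finiteDimensional (Algebra.IsIntegral.isIntegral α)

/-- The Mahler measure of the integral minimal polynomial of an algebraic number. -/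
noncomputable def numberMahler (α : Qbar) : ℝ :=
  ((intMinpoly α).map (Int.castRingHom ℂ)).mahlerMeasure

theorem intMinpoly_ne_zero (α : Qbar) : intMinpoly α ≠ 0 := (intMinpoly_spec α).1.ne_zero

theorem natDegree_intMinpoly (α : Qbar) :
    (intMinpoly α).natDegree = Module.finrank ℚ ℚ⟮α⟯ := by
  have hα : IsIntegral ℚ α := Algebra.IsIntegral.isIntegral α
  have h := congrArg natDegree (intMinpoly_spec α).2.2
  rw [natDegree_map_eq_of_injective (RingHom.injective_int (Int.castRingHom ℚ)),
    natDegree_C_mul (by exact_mod_cast (intMinpoly_spec α).2.1.ne')] at h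
  rw [h, adjoin.finrank hα]

theorem aeval_intMinpoly (α : Qbar) : aeval α (intMinpoly α) = 0 := by
  have h := congrArg (aeval α) (intMinpoly_spec α).2.2
  rw [map_mul, minpoly.aeval, mul_zero] at h
  exact (aeval_map_algebraMap ℚ α (intMinpoly α)).symm.trans h

theorem one_le_numberMahler (α : Qbar) : 1 ≤ numberMahler α :=
  one_le_mahlerMeasure_of_ne_zero (intMinpoly_ne_zero α)

theorem card_root_fiber_le {β : Type*} [DecidableEq β] (F : Finset Qbar) (p : β → Qbar[X])
    {f : Qbar → β} (hp : ∀ α ∈ F, p (f α) ≠ 0 ∧ (p (f α)).IsRoot α) {α : Qbar} (hα : α ∈ F) :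
    (F.filter fun x => f x = f α).card ≤ (p (f α)).natDegree := by
  classical
  have hsub : (F.filter fun x => f x = f α) ⊆ (p (f α)).roots.toFinset := by
    intro x hx
    obtain ⟨hxF, hxf⟩ := Finset.mem_filter.mp hx
    rw [Multiset.mem_toFinset, mem_roots (hp α hα).1, ← hxf]
    exact (hp x hxF).2
  exact (Finset.card_le_card hsub).trans ((Multiset.toFinset_card_le _).trans (card_roots' _))

theorem card_numberMahler_le {d : ℕ} {T : ℝ} (hT : 1 ≤ T) (F : Finset Qbar)
    (hF : ∀ α ∈ F, Module.finrank ℚ ℚ⟮α⟯ = d ∧ numberMahler α ≤ T) :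
    (F.card : ℝ) ≤ d * (2 ^ (d + 2) * T) ^ (d + 1) := by
  classical
  let B : NNReal := ⟨T, zero_le_one.trans hT⟩
  have hfin := finite_mahlerMeasure_le d B
  have hcard := card_mahlerMeasure_le_prod d B
  have h1 := card_le_sum_image F intMinpoly (fun _ => (d : ℝ)) (fun α hα => by
    have h2 := card_root_fiber_le F (fun D : ℤ[X] => D.map (algebraMap ℤ Qbar))
      (f := intMinpoly) (fun x _ => ⟨?_, ?_⟩) hα
    · refine Nat.cast_le.mpr (h2.trans ?_)
      exact natDegree_map_le.trans (by rw [natDegree_intMinpoly, (hF α hα).1])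
    · exact (Polynomial.map_ne_zero_iff (RingHom.injective_int _)).mpr (intMinpoly_ne_zero x)
    · rw [IsRoot.def, eval_map_algebraMap]
      exact aeval_intMinpoly x)
  rw [Finset.sum_const, nsmul_eq_mul, mul_comm] at h1
  refine h1.trans (mul_le_mul_of_nonneg_left ?_ (Nat.cast_nonneg d))
  have h3 : (F.image intMinpoly).card ≤ ∏ i : Fin (d + 1), (2 * ⌊d.choose i * B⌋₊ + 1) := by
    refine le_trans ?_ hcard
    rw [← Set.ncard_coe_finset]
    refine Set.ncard_le_ncard ?_ hfin
    intro D hD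
    obtain ⟨α, hα, rfl⟩ := Finset.mem_image.mp hD
    exact ⟨by rw [natDegree_intMinpoly, (hF α hα).1], (hF α hα).2⟩
  calc ((F.image intMinpoly).card : ℝ) ≤ ∏ i : Fin (d + 1), (2 * (⌊d.choose i * B⌋₊ : ℝ) + 1) := by
        exact_mod_cast h3
    _ ≤ ∏ i : Fin (d + 1), (2 ^ (d + 2) * T) := by
        refine Finset.prod_le_prod (fun _ _ => by positivity) fun i _ => ?_
        have h4 : ((⌊d.choose i * B⌋₊ : ℕ) : ℝ) ≤ d.choose i * T := by
          have := Nat.floor_le (zero_le : 0 ≤ (d.choose i : NNReal) * B)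
          exact_mod_cast this
        have h5 : (d.choose i : ℝ) * T ≤ 2 ^ d * T := by
          gcongr
          exact_mod_cast Nat.choose_le_two_pow d i
        have h6 : (1 : ℝ) ≤ 2 ^ d * T :=
          one_le_mul_of_one_le_of_one_le (one_le_pow₀ one_le_two) hT
        rw [pow_add]
        linarith
    _ = (2 ^ (d + 2) * T) ^ (d + 1) := by simp

theorem minpoly_coe_intermediateField {K : IntermediateField ℚ Qbar} (b : K) :
    minpoly ℚ (b : Qbar) = minpoly ℚ b :=
  minpoly.algebraMap_eq (algebraMap K Qbar).injective b

theorem exists_numberMahler_pow_le {K : IntermediateField ℚ Qbar} [NumberField K] (b : K) :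
    ∃ m : ℕ, Module.finrank ℚ ℚ⟮(b : Qbar)⟯ * m = Module.finrank ℚ K ∧
      numberMahler (b : Qbar) ^ m ≤ tupleHeight fun _ : Unit => b := by
  refine ⟨Module.finrank ℚ⟮b⟯ K, ?_, ?_⟩
  · rw [adjoin.finrank (Algebra.IsIntegral.isIntegral _), minpoly_coe_intermediateField,
      ← adjoin.finrank (Algebra.IsIntegral.isIntegral b), Module.finrank_mul_finrank]
  · refine mahlerMeasure_pow_le_tupleHeight (intMinpoly_spec (b : Qbar)).1 ?_
    rw [← minpoly_coe_intermediateField]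
    exact (intMinpoly_spec (b : Qbar)).2.2

/-- The height relative to `K` dominates the `m`-th power of the Mahler measure, where `m` is the
degree of `K` over `ℚ(b)`; an `m`-th root is taken. So entries of small degree have small Mahler
measure. -/
theorem numberMahler_le_pow {K : IntermediateField ℚ Qbar} [NumberField K] {b : K} {Y : ℝ}
    (hY : 0 ≤ Y) (h : tupleHeight (fun _ : Unit => b) ≤ Y ^ Module.finrank ℚ K) :
    numberMahler (b : Qbar) ≤ Y ^ Module.finrank ℚ ℚ⟮(b : Qbar)⟯ := by
  obtain ⟨m, hm, hle⟩ := exists_numberMahler_pow_le b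
  have hm0 : m ≠ 0 := by
    rintro rfl
    rw [mul_zero] at hm
    exact Module.finrank_pos.ne hm
  refine le_of_pow_le_pow_left₀ hm0 (by positivity) ?_
  rw [← pow_mul, hm]
  exact hle.trans h

theorem tupleHeight_gen (α : Qbar) :
    tupleHeight (fun _ : Unit => AdjoinSimple.gen ℚ α) =
      NumberField.absMulHeight₁ α ^ Module.finrank ℚ ℚ⟮α⟯ := by
  have hα : IsIntegral ℚ α := Algebra.IsIntegral.isIntegral α
  rw [← mulHeight₁_eq_tupleHeight, NumberField.absMulHeight₁, dif_pos hα,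
    Real.rpow_inv_natCast_pow (Height.mulHeight₁_nonneg _) Module.finrank_pos.ne']

theorem one_le_absMulHeight₁ (α : Qbar) : 1 ≤ NumberField.absMulHeight₁ α := by
  have hα : IsIntegral ℚ α := Algebra.IsIntegral.isIntegral α
  rw [NumberField.absMulHeight₁, dif_pos hα]
  exact Real.one_le_rpow (Height.one_le_mulHeight₁ _) (by positivity)

theorem numberMahler_le_absMulHeight₁_pow (α : Qbar) :
    numberMahler α ≤ NumberField.absMulHeight₁ α ^ Module.finrank ℚ ℚ⟮α⟯ := by
  have h := numberMahler_le_pow (K := ℚ⟮α⟯) (b := AdjoinSimple.gen ℚ α)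
    (zero_le_one.trans (one_le_absMulHeight₁ α)) (tupleHeight_gen α).le
  exact h

end AlgebraicNumbers

/-! ### Tuples with an entry that generates the whole field. -/

section TupleField

open NumberField

/-- The field generated by a tuple of algebraic numbers. -/
noncomputable def tupleField {ι : Type*} (c : ι → Qbar) : IntermediateField ℚ Qbar :=
  adjoin ℚ (Set.range c)

/-- A tuple of algebraic numbers as a tuple in the field it generates. -/
noncomputable def tupleGen {ι : Type*} (c : ι → Qbar) (i : ι) : tupleField c :=
  ⟨c i, subset_adjoin ℚ _ (Set.mem_range_self i)⟩

instance numberField_tupleField {ι : Type*} [Finite ι] (c : ι → Qbar) :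
    NumberField (tupleField c) where
  to_finiteDimensional :=
    have : Finite (Set.range c) := Set.finite_range c
    finiteDimensional_adjoin fun x _ => Algebra.IsIntegral.isIntegral x

theorem mem_tupleField {ι : Type*} (c : ι → Qbar) (i : ι) : c i ∈ tupleField c :=
  (tupleGen c i).2

theorem tupleHeight_tupleGen {ι : Type*} [Fintype ι] {c : ι → Qbar} {K : IntermediateField ℚ Qbar}
    [NumberField K] (hK : tupleField c = K) {c' : ι → K} (hc : ∀ i, (c' i : Qbar) = c i) :
    tupleHeight (tupleGen c) = tupleHeight c' := by
  subst hK
  have : c' = tupleGen c := by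
    ext i
    exact hc i
  rw [this]

theorem card_tuples_field_le {ι : Type*} [Fintype ι] [DecidableEq ι] (S : Finset ι)
    (b : S → Qbar) {Z : ℝ} (hZ : 0 ≤ Z) (F : Finset (ι → Qbar))
    (hF : ∀ c ∈ F, (∀ i : S, c i = b i) ∧ tupleField c = tupleField b ∧
      tupleHeight (tupleGen c) ≤ Z) :
    (F.card : ℝ) ≤ (Z / tupleHeight (tupleGen b)) ^ 2 * 8 ^ Module.finrank ℚ (tupleField b) *
      (8 ^ Module.finrank ℚ (tupleField b) * Z) ^ (Fintype.card ι - S.card) := by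
  classical
  have hmem : ∀ c ∈ F, ∀ i, c i ∈ tupleField b := fun c hc i =>
    (hF c hc).2.1 ▸ mem_tupleField c i
  let g : {c // c ∈ F} → ι → tupleField b := fun c i => ⟨c.1 i, hmem c.1 c.2 i⟩
  have hg : Function.Injective g := by
    intro c c' h
    ext i
    exact congrArg Subtype.val (congrFun h i)
  have h := card_tuples_le S (tupleGen b) hZ (F.attach.image g) (by
    intro x hx
    obtain ⟨c, -, rfl⟩ := Finset.mem_image.mp hx
    refine ⟨fun i => Subtype.ext ((hF c.1 c.2).1 i), ?_⟩
    rw [← tupleHeight_tupleGen (hF c.1 c.2).2.1 (c' := g c) fun _ => rfl]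
    exact (hF c.1 c.2).2.2)
  rwa [Finset.card_image_of_injective _ hg, Finset.card_attach] at h

/-- Dyadic summation: elements with `Z/h` near `2^k` have weight at most `4^(k+1)` and number at
most `C Z^p 8^(-k)`. The exponent must exceed 2 for the sum over `k` to converge. -/
theorem sum_div_sq_le {α : Type*} (F : Finset α) (h : α → ℝ) {C Z : ℝ} {p : ℕ} (hp : 3 ≤ p)
    (hC : 0 ≤ C) (hZ0 : 0 ≤ Z) (h1 : ∀ a ∈ F, 1 ≤ h a) (hZ : ∀ a ∈ F, h a ≤ Z)
    (hcount : ∀ T : ℝ, 1 ≤ T → ((F.filter fun a => h a ≤ T).card : ℝ) ≤ C * T ^ p) :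
    ∑ a ∈ F, (Z / h a) ^ 2 ≤ 8 * C * Z ^ p := by
  rcases F.eq_empty_or_nonempty with rfl | ⟨a₀, ha₀⟩
  · simp only [Finset.sum_empty]
    positivity
  have hZ1 : 1 ≤ Z := (h1 a₀ ha₀).trans (hZ a₀ ha₀)
  obtain ⟨N, hN⟩ := pow_unbounded_of_one_lt Z (one_lt_two)
  have hterm : ∀ a ∈ F, (Z / h a) ^ 2 ≤
      ∑ k ∈ Finset.range N, if h a ≤ Z / 2 ^ k then (4 : ℝ) ^ (k + 1) else 0 := by
    intro a ha
    have hpos : 0 < h a := zero_lt_one.trans_le (h1 a ha)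
    obtain ⟨k, hk1, hk2⟩ := exists_nat_pow_near ((one_le_div hpos).mpr (hZ a ha))
      (one_lt_two : (1 : ℝ) < 2)
    have hkN : k < N := by
      have h2 : Z / h a ≤ Z := div_le_self (by linarith) (h1 a ha)
      exact (pow_lt_pow_iff_right₀ (one_lt_two : (1 : ℝ) < 2)).mp
        ((hk1.trans h2).trans_lt hN)
    have hle : h a ≤ Z / 2 ^ k := by
      rw [le_div_iff₀ (by positivity), mul_comm]
      rwa [le_div_iff₀ hpos] at hk1
    calc (Z / h a) ^ 2 ≤ (2 ^ (k + 1)) ^ 2 :=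
          pow_le_pow_left₀ (div_nonneg (by linarith) hpos.le) hk2.le 2
      _ = if h a ≤ Z / 2 ^ k then (4 : ℝ) ^ (k + 1) else 0 := by
          rw [if_pos hle, ← pow_mul, mul_comm, pow_mul]
          norm_num
      _ ≤ _ := Finset.single_le_sum
          (f := fun k => if h a ≤ Z / 2 ^ k then (4 : ℝ) ^ (k + 1) else 0)
          (fun k _ => by positivity) (Finset.mem_range.mpr hkN)
  have hk : ∀ k ∈ Finset.range N, ∑ a ∈ F, (if h a ≤ Z / 2 ^ k then (4 : ℝ) ^ (k + 1) else 0) ≤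
      4 * C * Z ^ p * (1 / 2) ^ k := by
    intro k _
    rw [← Finset.sum_filter, Finset.sum_const, nsmul_eq_mul]
    rcases le_or_gt 1 (Z / 2 ^ k) with hge | hlt
    · have h3 : (Z / 2 ^ k) ^ p ≤ Z ^ p * (1 / 8) ^ k := by
        rw [div_pow, ← pow_mul, mul_comm k p, pow_mul, div_eq_mul_inv, ← inv_pow]
        gcongr
        rw [one_div]
        gcongr
        calc (8 : ℝ) = 2 ^ 3 := by norm_num
          _ ≤ 2 ^ p := pow_le_pow_right₀ one_le_two hp
      calc _ ≤ C * (Z ^ p * (1 / 8) ^ k) * 4 ^ (k + 1) :=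
            mul_le_mul_of_nonneg_right ((hcount _ hge).trans
              (mul_le_mul_of_nonneg_left h3 hC)) (by positivity)
        _ = 4 * C * Z ^ p * ((1 / 8) * 4) ^ k := by
            rw [mul_pow, pow_succ]
            ring
        _ = _ := by norm_num
    · rw [Finset.filter_false_of_mem fun a ha => not_le.mpr (hlt.trans_le (h1 a ha))]
      simp only [Finset.card_empty, Nat.cast_zero, zero_mul]
      positivity
  have hgeom : ∑ k ∈ Finset.range N, (1 / 2 : ℝ) ^ k ≤ 2 := by
    have h := Summable.sum_le_tsum (Finset.range N) (fun k _ => by positivity)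
      summable_geometric_two
    rwa [tsum_geometric_two] at h
  calc _ ≤ ∑ a ∈ F, ∑ k ∈ Finset.range N, (if h a ≤ Z / 2 ^ k then (4 : ℝ) ^ (k + 1) else 0) :=
        Finset.sum_le_sum hterm
    _ = ∑ k ∈ Finset.range N, ∑ a ∈ F, (if h a ≤ Z / 2 ^ k then (4 : ℝ) ^ (k + 1) else 0) :=
        Finset.sum_comm
    _ ≤ ∑ k ∈ Finset.range N, 4 * C * Z ^ p * (1 / 2) ^ k := Finset.sum_le_sum hk
    _ = 4 * C * Z ^ p * ∑ k ∈ Finset.range N, (1 / 2 : ℝ) ^ k := by rw [Finset.mul_sum]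
    _ ≤ 4 * C * Z ^ p * 2 := by gcongr
    _ = _ := by ring

theorem numberMahler_le_tupleHeight {ι : Type*} [Fintype ι] {c : ι → Qbar} {i : ι}
    (h : tupleField c = ℚ⟮c i⟯) : numberMahler (c i) ≤ tupleHeight (tupleGen c) := by
  obtain ⟨m, hm, hle⟩ := exists_numberMahler_pow_le (tupleGen c i)
  have hm1 : m = 1 := by
    have h1 : Module.finrank ℚ ℚ⟮c i⟯ * m = Module.finrank ℚ ℚ⟮c i⟯ * 1 := by
      rw [mul_one]
      exact hm.trans (by rw [h])
    exact Nat.eq_of_mul_eq_mul_left Module.finrank_pos h1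
  rw [hm1, pow_one] at hle
  exact hle.trans (tupleHeight_comp_le (tupleGen c) fun _ : Unit => i)

theorem card_tuples_simple_le {n e : ℕ} (he : 2 ≤ e) {Z : ℝ} (hZ : 1 ≤ Z) (i : Fin n)
    (F : Finset (Fin n → Qbar))
    (hF : ∀ c ∈ F, tupleField c = ℚ⟮c i⟯ ∧ Module.finrank ℚ (tupleField c) = e ∧
      tupleHeight (tupleGen c) ≤ Z) :
    (F.card : ℝ) ≤ e * 2 ^ (e ^ 2 + 3 * e + 5 + 3 * e * n) * Z ^ (n + e) := by
  classical
  have hn : 1 ≤ n := Fin.pos i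
  set W : ℝ := 8 ^ e * (8 ^ e * Z) ^ (n - 1) with hW
  have h1 := card_le_sum_image F (fun c => c i) (fun β => (Z / numberMahler β) ^ 2 * W) (by
    intro c hc
    set b : ({i} : Finset (Fin n)) → Qbar := fun _ => c i with hb
    have hbK : tupleField b = ℚ⟮c i⟯ := by
      unfold tupleField
      congr 1
      ext x
      simp [hb]
    have hbe : Module.finrank ℚ (tupleField b) = e := by
      rw [hbK, ← (hF c hc).1]
      exact (hF c hc).2.1
    have h2 := card_tuples_field_le {i} b (zero_le_one.trans hZ)
      (F.filter fun x => x i = c i) (by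
      intro x hx
      obtain ⟨hxF, hxi⟩ := Finset.mem_filter.mp hx
      refine ⟨?_, ?_, (hF x hxF).2.2⟩
      · rintro ⟨j, hj⟩
        rw [Finset.mem_singleton] at hj
        subst hj
        exact hxi
      · rw [hbK, (hF x hxF).1, hxi])
    rw [hbe, Finset.card_singleton, Fintype.card_fin, mul_assoc, ← hW] at h2
    refine h2.trans ?_
    have h3 : numberMahler (c i) ≤ tupleHeight (tupleGen b) :=
      numberMahler_le_tupleHeight (c := b) (i := ⟨i, Finset.mem_singleton_self i⟩) hbK
    have h4 := one_le_numberMahler (c i)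
    have h5 : 0 ≤ Z / tupleHeight (tupleGen b) :=
      div_nonneg (zero_le_one.trans hZ) (zero_le_one.trans (one_le_tupleHeight _))
    gcongr)
  rw [← Finset.sum_mul] at h1
  have hβ : ∀ β ∈ F.image (fun c => c i), Module.finrank ℚ ℚ⟮β⟯ = e ∧ numberMahler β ≤ Z := by
    intro β hβ
    obtain ⟨c, hc, rfl⟩ := Finset.mem_image.mp hβ
    refine ⟨?_, (numberMahler_le_tupleHeight (hF c hc).1).trans (hF c hc).2.2⟩
    rw [← (hF c hc).1]
    exact (hF c hc).2.1
  -- Here `p = e + 1`, and `p ≥ 3` is where `e ≥ 2` enters.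
  have h5 := sum_div_sq_le (F.image fun c => c i) numberMahler (Z := Z)
    (C := e * 2 ^ ((e + 2) * (e + 1))) (p := e + 1) (by omega) (by positivity) (by positivity)
    (fun β _ => one_le_numberMahler β) (fun β hb => (hβ β hb).2) (by
      intro T hT
      have := card_numberMahler_le (d := e) hT
        ((F.image fun c => c i).filter fun β => numberMahler β ≤ T) (by
          intro β hb
          obtain ⟨hb1, hb2⟩ := Finset.mem_filter.mp hb
          exact ⟨(hβ β hb1).1, hb2⟩)
      rwa [mul_pow, ← pow_mul, ← mul_assoc] at this)
  calc (F.card : ℝ) ≤ (8 * (e * 2 ^ ((e + 2) * (e + 1))) * Z ^ (e + 1)) * W :=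
        h1.trans (mul_le_mul_of_nonneg_right h5 (by positivity))
    _ = _ := by
        obtain ⟨m, rfl⟩ := Nat.exists_eq_add_of_le hn
        rw [hW, show (8 : ℝ) = 2 ^ 3 by norm_num, show 1 + m - 1 = m by omega, mul_pow,
          ← pow_mul, ← pow_mul]
        ring

end TupleField

/-! ### Tuples without a generating entry, and the full tuple count. -/

section TupleCount

open NumberField

theorem two_mul_finrank_le_of_lt {A B : IntermediateField ℚ Qbar} [FiniteDimensional ℚ B]
    (h : A < B) : 2 * Module.finrank ℚ A ≤ Module.finrank ℚ B := by
  obtain ⟨m, hm⟩ := finrank_dvd_of_le_right h.le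
  have hB : 0 < Module.finrank ℚ B := Module.finrank_pos
  have h1 : m ≠ 1 := by
    rintro rfl
    exact h.ne (eq_of_le_of_finrank_eq h.le (by rw [hm, mul_one]))
  have h0 : m ≠ 0 := by
    rintro rfl
    simp [hm] at hB
  rw [hm, mul_comm]
  exact Nat.mul_le_mul_left _ (by omega)

theorem tupleField_comp_le {ι κ : Type*} (c : ι → Qbar) (f : κ → ι) :
    tupleField (c ∘ f) ≤ tupleField c :=
  adjoin.mono ℚ _ _ (Set.range_comp_subset_range f c)

/-- Start from an entry of maximal degree `d` and adjoin further entries; each proper enlargement at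
least doubles the degree. A maximal set `S` with `d 2^(|S|-1) ≤ [ℚ(S) : ℚ]` therefore generates the
field, and `|S| ≤ 2^(|S|-1)` gives the final inequality. -/
theorem exists_chain {ι : Type*} [Fintype ι] (c : ι → Qbar)
    (he : 2 ≤ Module.finrank ℚ (tupleField c)) (hne : ∀ i, tupleField c ≠ ℚ⟮c i⟯) :
    ∃ (S : Finset ι) (d : ℕ), tupleField (c ∘ (Subtype.val : S → ι)) = tupleField c ∧
      (∀ i, Module.finrank ℚ ℚ⟮c i⟯ ≤ d) ∧ 1 ≤ d ∧ 2 ≤ S.card ∧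
      S.card * d ≤ Module.finrank ℚ (tupleField c) := by
  classical
  have hι : Nonempty ι := by
    by_contra h
    rw [not_nonempty_iff] at h
    have : tupleField c = ⊥ := by
      unfold tupleField
      rw [Set.range_eq_empty, adjoin_empty]
    rw [this, IntermediateField.finrank_bot] at he
    omega
  obtain ⟨i₀, -, hi₀⟩ := Finset.exists_max_image Finset.univ
    (fun i => Module.finrank ℚ ℚ⟮c i⟯) Finset.univ_nonempty
  set d := Module.finrank ℚ ℚ⟮c i₀⟯ with hd
  let T : Finset ι → IntermediateField ℚ Qbar := fun S => tupleField (c ∘ (Subtype.val : S → ι))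
  have hTi₀ : T {i₀} = ℚ⟮c i₀⟯ := by
    change adjoin ℚ _ = _
    congr 1
    ext x
    simp [eq_comm]
  obtain ⟨S, hS, hmax⟩ := (Finset.univ.filter fun S : Finset ι => i₀ ∈ S ∧
    d * 2 ^ (S.card - 1) ≤ Module.finrank ℚ (T S)).exists_maximal ⟨{i₀}, Finset.mem_filter.mpr
      ⟨Finset.mem_univ _, Finset.mem_singleton_self _, by rw [hTi₀]; simp [hd]⟩⟩
  simp only [Finset.mem_filter, Finset.mem_univ, true_and] at hS hmax
  have hSc : 1 ≤ S.card := Finset.card_pos.mpr ⟨i₀, hS.1⟩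
  have hT : T S = tupleField c := by
    refine le_antisymm (tupleField_comp_le c _) ?_
    unfold tupleField
    rw [adjoin_le_iff]
    rintro _ ⟨i, rfl⟩
    by_contra hi
    have hiS : i ∉ S := fun h => hi (mem_tupleField (c ∘ (Subtype.val : S → ι)) ⟨i, h⟩)
    have hlt : T S < T (insert i S) := by
      refine lt_of_le_of_ne ?_ fun h => hi ?_
      · exact tupleField_comp_le (c ∘ (Subtype.val : ↥(insert i S) → ι))
          fun j : S => ⟨j.1, Finset.mem_insert_of_mem j.2⟩
      · change c i ∈ T S
        rw [h]
        exact mem_tupleField (c ∘ (Subtype.val : ↥(insert i S) → ι))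
          ⟨i, Finset.mem_insert_self i S⟩
    have h2 := two_mul_finrank_le_of_lt hlt
    refine hiS (hmax (y := insert i S) ⟨Finset.mem_insert_of_mem hS.1, ?_⟩
      (Finset.subset_insert i S) (Finset.mem_insert_self i S))
    rw [Finset.card_insert_of_notMem hiS, Nat.add_sub_cancel]
    refine le_trans ?_ h2
    obtain ⟨m, hm⟩ := Nat.exists_eq_add_of_le hSc
    have h3 := hS.2
    rw [hm] at h3 ⊢
    rw [Nat.add_sub_cancel_left] at h3
    rw [pow_add, pow_one]
    nlinarith
  refine ⟨S, d, hT, fun i => hi₀ i (Finset.mem_univ i), Module.finrank_pos, ?_, ?_⟩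
  · by_contra h
    have h1 : S = {i₀} := by
      obtain ⟨x, hx⟩ := Finset.card_eq_one.mp (show S.card = 1 by omega)
      have := hS.1
      rw [hx, Finset.mem_singleton] at this
      rw [hx, this]
    rw [h1, hTi₀] at hT
    exact hne i₀ hT.symm
  · have h1 : S.card ≤ 2 ^ (S.card - 1) := by
      have := Nat.lt_two_pow_self (n := S.card - 1)
      omega
    rw [← hT]
    refine le_trans ?_ hS.2
    rw [mul_comm]
    exact Nat.mul_le_mul_left d h1

theorem card_numberMahler_le_pow {d : ℕ} {Y : ℝ} (hY : 1 ≤ Y) (E : Finset Qbar)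
    (hE : ∀ β ∈ E, Module.finrank ℚ ℚ⟮β⟯ ≤ d ∧
      numberMahler β ≤ Y ^ Module.finrank ℚ ℚ⟮β⟯) :
    (E.card : ℝ) ≤ d * (d * (2 ^ (d + 2) * Y ^ d) ^ (d + 1)) := by
  classical
  have h := card_le_sum_image E (fun β => Module.finrank ℚ ℚ⟮β⟯)
    (fun _ => (d : ℝ) * (2 ^ (d + 2) * Y ^ d) ^ (d + 1)) (by
    intro β hβ
    have h1 := card_numberMahler_le (d := Module.finrank ℚ ℚ⟮β⟯)
      (one_le_pow₀ hY (n := Module.finrank ℚ ℚ⟮β⟯))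
      (E.filter fun x => Module.finrank ℚ ℚ⟮x⟯ = Module.finrank ℚ ℚ⟮β⟯) (by
        intro x hx
        obtain ⟨hxE, hx1⟩ := Finset.mem_filter.mp hx
        exact ⟨hx1, hx1 ▸ (hE x hxE).2⟩)
    refine h1.trans ?_
    have h2 := (hE β hβ).1
    have h3 : (1 : ℝ) ≤ 2 ^ (d + 2) * Y ^ d :=
      one_le_mul_of_one_le_of_one_le (one_le_pow₀ one_le_two) (one_le_pow₀ hY)
    calc _ ≤ (d : ℝ) * (2 ^ (d + 2) * Y ^ d) ^ (Module.finrank ℚ ℚ⟮β⟯ + 1) := by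
          gcongr
          exact one_le_two
      _ ≤ _ := by gcongr)
  rw [Finset.sum_const, nsmul_eq_mul] at h
  refine h.trans (mul_le_mul_of_nonneg_right ?_ (by positivity))
  have hsub : E.image (fun β => Module.finrank ℚ ℚ⟮β⟯) ⊆ Finset.Icc 1 d := by
    intro m hm
    obtain ⟨β, hβ, rfl⟩ := Finset.mem_image.mp hm
    exact Finset.mem_Icc.mpr ⟨Module.finrank_pos, (hE β hβ).1⟩
  have := Finset.card_le_card hsub
  rw [Nat.card_Icc, Nat.add_sub_cancel] at this
  exact_mod_cast this

/-- Every entry comes from a pool of `≪ Y^(d(d+1))` numbers, so with `k = |S|` there are `≪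
Y^(kd(d+1)) ≤ Y^(e(d+1))` partial tuples. Each is completed using only the trivial bound `H(b) ≥ 1`.
-/
theorem card_tuples_chain_le {n e d : ℕ} (S : Finset (Fin n)) (hd : 1 ≤ d) (hS : 2 ≤ S.card)
    (hSd : S.card * d ≤ e) {Y : ℝ} (hY : 1 ≤ Y) (F : Finset (Fin n → Qbar))
    (hF : ∀ c ∈ F, tupleField (c ∘ (Subtype.val : S → Fin n)) = tupleField c ∧
      (∀ i, Module.finrank ℚ ℚ⟮c i⟯ ≤ d) ∧ Module.finrank ℚ (tupleField c) = e ∧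
      tupleHeight (tupleGen c) ≤ Y ^ e) :
    (F.card : ℝ) ≤ 2 ^ (e ^ 2 + 4 * e + 3 * e * n) * (Y ^ e) ^ (n + e) := by
  classical
  set k := S.card with hk
  have hkn : k ≤ n := by simpa using S.card_le_univ
  set W : ℝ := (Y ^ e) ^ 2 * 8 ^ e * (8 ^ e * Y ^ e) ^ (n - k) with hW
  set N : ℝ := d * (d * (2 ^ (d + 2) * Y ^ d) ^ (d + 1)) with hN
  have h1 := card_le_sum_image F (fun c => c ∘ (Subtype.val : S → Fin n)) (fun _ => W) (by
    intro c hc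
    have h2 := card_tuples_field_le S (c ∘ (Subtype.val : S → Fin n))
      (Z := Y ^ e) (by positivity)
      (F.filter fun x => x ∘ (Subtype.val : S → Fin n) = c ∘ (Subtype.val : S → Fin n)) (by
        intro x hx
        obtain ⟨hxF, hxc⟩ := Finset.mem_filter.mp hx
        exact ⟨fun i => congrFun hxc i, by rw [← hxc, (hF x hxF).1], (hF x hxF).2.2.2⟩)
    have h3 : Module.finrank ℚ (tupleField (c ∘ (Subtype.val : S → Fin n))) = e := by
      rw [(hF c hc).1, (hF c hc).2.2.1]
    rw [h3, Fintype.card_fin, ← hk] at h2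
    refine h2.trans ?_
    have h4 := one_le_tupleHeight (tupleGen (c ∘ (Subtype.val : S → Fin n)))
    have h5 : Y ^ e / tupleHeight (tupleGen (c ∘ (Subtype.val : S → Fin n))) ≤ Y ^ e :=
      div_le_self (by positivity) h4
    have h6 : 0 ≤ Y ^ e / tupleHeight (tupleGen (c ∘ (Subtype.val : S → Fin n))) :=
      div_nonneg (by positivity) (zero_le_one.trans h4)
    rw [hW]
    gcongr)
  rw [Finset.sum_const, nsmul_eq_mul] at h1
  have hE : ((F.biUnion fun c => Finset.univ.image c).card : ℝ) ≤ N := by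
    refine card_numberMahler_le_pow hY _ fun β hβ => ?_
    obtain ⟨c, hc, hβc⟩ := Finset.mem_biUnion.mp hβ
    obtain ⟨i, -, rfl⟩ := Finset.mem_image.mp hβc
    refine ⟨(hF c hc).2.1 i, ?_⟩
    refine numberMahler_le_pow (b := tupleGen c i) (zero_le_one.trans hY) ?_
    rw [(hF c hc).2.2.1]
    exact (tupleHeight_comp_le (tupleGen c) fun _ : Unit => i).trans (hF c hc).2.2.2
  have himg : ((F.image fun c => c ∘ (Subtype.val : S → Fin n)).card : ℝ) ≤ N ^ k := by
    have hsub : F.image (fun c => c ∘ (Subtype.val : S → Fin n)) ⊆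
        Fintype.piFinset fun _ : S => F.biUnion fun c => Finset.univ.image c := by
      intro b hb
      obtain ⟨c, hc, rfl⟩ := Finset.mem_image.mp hb
      refine Fintype.mem_piFinset.mpr fun i => Finset.mem_biUnion.mpr ⟨c, hc, ?_⟩
      exact Finset.mem_image_of_mem _ (Finset.mem_univ _)
    have h3 := Finset.card_le_card hsub
    rw [Fintype.card_piFinset, Finset.prod_const, Finset.card_univ, Fintype.card_coe, ← hk] at h3
    calc _ ≤ ((F.biUnion fun c => Finset.univ.image c).card : ℝ) ^ k := by exact_mod_cast h3
      _ ≤ N ^ k := by gcongr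
  have hNle : N ≤ 2 ^ (d + d + (d + 2) * (d + 1)) * Y ^ (d * (d + 1)) := by
    have h4 : (d : ℝ) ≤ 2 ^ d := by exact_mod_cast Nat.lt_two_pow_self.le
    calc N ≤ 2 ^ d * (2 ^ d * (2 ^ (d + 2) * Y ^ d) ^ (d + 1)) := by rw [hN]; gcongr
      _ = _ := by
        rw [mul_pow, ← pow_mul, ← pow_mul]
        ring
  obtain ⟨m, hm⟩ := Nat.exists_eq_add_of_le hkn
  have hke : k ≤ e := (Nat.le_mul_of_pos_right k hd).trans hSd
  have h2d : 2 * d ≤ e := (Nat.mul_le_mul_right d hS).trans hSd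
  calc (F.card : ℝ) ≤ (2 ^ (d + d + (d + 2) * (d + 1)) * Y ^ (d * (d + 1))) ^ k * W := by
        refine h1.trans (mul_le_mul_of_nonneg_right (himg.trans ?_) (by positivity))
        gcongr
    _ = 2 ^ ((d + d + (d + 2) * (d + 1)) * k + 3 * e + 3 * e * m) *
          Y ^ (d * (d + 1) * k + e * (2 + m)) := by
        rw [hW, show (8 : ℝ) = 2 ^ 3 by norm_num, show n - k = m by omega, mul_pow,
          mul_pow (_ ^ e) (Y ^ e) m]
        simp only [← pow_mul]
        ring
    _ ≤ 2 ^ (e ^ 2 + 4 * e + 3 * e * (k + m)) * Y ^ (e * (k + m + e)) := by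
        have h5 : (d + d + (d + 2) * (d + 1)) * k + 3 * e + 3 * e * m ≤
            e ^ 2 + 4 * e + 3 * e * (k + m) := by
          have h6 : k * d * d ≤ e * d := Nat.mul_le_mul_right d hSd
          have h7 : e * (2 * d) ≤ e * e := Nat.mul_le_mul_left e h2d
          have h8 : e * 2 ≤ e * k := Nat.mul_le_mul_left e hS
          nlinarith
        -- After `kd ≤ e` this reduces to `d + 3 ≤ k + e`, which follows from `k ≥ 2`, `2d ≤ e` and
        -- `d ≥ 1`.
        have h9 : d * (d + 1) * k + e * (2 + m) ≤ e * (k + m + e) := by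
          have h10 : k * d * (d + 1) ≤ e * (d + 1) := Nat.mul_le_mul_right _ hSd
          have h11 : e * (d + 3) ≤ e * (k + e) := Nat.mul_le_mul_left e (by omega)
          nlinarith
        gcongr
        · exact one_le_two
    _ = _ := by rw [hm, ← pow_mul]

theorem card_tuples_generating_le {n e : ℕ} (he : 2 ≤ e) {Y : ℝ} (hY : 1 ≤ Y)
    (F : Finset (Fin n → Qbar))
    (hF : ∀ c ∈ F, Module.finrank ℚ (tupleField c) = e ∧ tupleHeight (tupleGen c) ≤ Y ^ e) :
    (F.card : ℝ) ≤ 2 ^ (e ^ 2 + 5 * e + n + 3 * e * n + 6) * (Y ^ e) ^ (n + e) := by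
  classical
  let A : Fin n → Finset (Fin n → Qbar) := fun i => F.filter fun c => tupleField c = ℚ⟮c i⟯
  let B : Finset (Fin n) × ℕ → Finset (Fin n → Qbar) := fun q =>
    F.filter fun c => tupleField (c ∘ (Subtype.val : q.1 → Fin n)) = tupleField c ∧
      (∀ i, Module.finrank ℚ ℚ⟮c i⟯ ≤ q.2) ∧ 1 ≤ q.2 ∧ 2 ≤ q.1.card ∧ q.1.card * q.2 ≤ e
  have hcover : F ⊆ Finset.univ.biUnion A ∪
      ((Finset.univ : Finset (Finset (Fin n))) ×ˢ Finset.Icc 1 e).biUnion B := by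
    intro c hc
    rw [Finset.mem_union, Finset.mem_biUnion, Finset.mem_biUnion]
    by_cases h : ∃ i, tupleField c = ℚ⟮c i⟯
    · obtain ⟨i, hi⟩ := h
      exact Or.inl ⟨i, Finset.mem_univ i, Finset.mem_filter.mpr ⟨hc, hi⟩⟩
    · push Not at h
      obtain ⟨S, d, h1, h2, h3, h4, h5⟩ := exists_chain c (by rw [(hF c hc).1]; exact he) h
      rw [(hF c hc).1] at h5
      refine Or.inr ⟨(S, d), Finset.mem_product.mpr ⟨Finset.mem_univ _, Finset.mem_Icc.mpr
        ⟨h3, ?_⟩⟩, Finset.mem_filter.mpr ⟨hc, h1, h2, h3, h4, h5⟩⟩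
      exact (Nat.le_mul_of_pos_left d (by omega)).trans h5
  have hYe : 1 ≤ Y ^ e := one_le_pow₀ hY
  have hA : ∀ i, ((A i).card : ℝ) ≤
      e * 2 ^ (e ^ 2 + 3 * e + 5 + 3 * e * n) * (Y ^ e) ^ (n + e) := fun i =>
    card_tuples_simple_le he hYe i (A i) fun c hc => by
      obtain ⟨hcF, hci⟩ := Finset.mem_filter.mp hc
      exact ⟨hci, hF c hcF⟩
  have hB : ∀ q, ((B q).card : ℝ) ≤
      2 ^ (e ^ 2 + 4 * e + 3 * e * n) * (Y ^ e) ^ (n + e) := by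
    intro q
    rcases (B q).eq_empty_or_nonempty with h | ⟨c₀, hc₀⟩
    · rw [h, Finset.card_empty, Nat.cast_zero]
      positivity
    · obtain ⟨-, -, -, h3, h4, h5⟩ := Finset.mem_filter.mp hc₀
      refine card_tuples_chain_le q.1 h3 h4 h5 hY _ fun c hc => ?_
      obtain ⟨hcF, h1, h2, -⟩ := Finset.mem_filter.mp hc
      exact ⟨h1, h2, hF c hcF⟩
  have hcard : (F.card : ℝ) ≤ ∑ i, ((A i).card : ℝ) +
      ∑ q ∈ (Finset.univ : Finset (Finset (Fin n))) ×ˢ Finset.Icc 1 e, ((B q).card : ℝ) := by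
    have := (Finset.card_le_card hcover).trans ((Finset.card_union_le _ _).trans
      (add_le_add Finset.card_biUnion_le Finset.card_biUnion_le))
    exact_mod_cast this
  have hn2 : (n : ℝ) ≤ 2 ^ n := by exact_mod_cast Nat.lt_two_pow_self.le
  have he2 : (e : ℝ) ≤ 2 ^ e := by exact_mod_cast Nat.lt_two_pow_self.le
  have hsumA := Finset.sum_le_sum fun i (_ : i ∈ Finset.univ) => hA i
  have hsumB := Finset.sum_le_sum fun q
    (_ : q ∈ (Finset.univ : Finset (Finset (Fin n))) ×ˢ Finset.Icc 1 e) => hB q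
  rw [Finset.sum_const, nsmul_eq_mul, Finset.card_univ, Fintype.card_fin] at hsumA
  rw [Finset.sum_const, nsmul_eq_mul, Finset.card_product, Finset.card_univ, Fintype.card_finset,
    Fintype.card_fin, Nat.card_Icc, Nat.add_sub_cancel] at hsumB
  push_cast at hsumB
  set P := (Y ^ e) ^ (n + e)
  set Q : ℝ := 2 ^ (e ^ 2 + 4 * e + n + 3 * e * n)
  have hP : 0 ≤ P := by positivity
  have hA' : (n : ℝ) * (e * 2 ^ (e ^ 2 + 3 * e + 5 + 3 * e * n) * P) ≤ 32 * Q * P := by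
    calc _ ≤ (2 : ℝ) ^ n * (2 ^ e * 2 ^ (e ^ 2 + 3 * e + 5 + 3 * e * n) * P) := by gcongr
      _ = _ := by ring
  have hB' : (2 : ℝ) ^ n * e * (2 ^ (e ^ 2 + 4 * e + 3 * e * n) * P) ≤ 2 ^ e * Q * P := by
    calc _ ≤ (2 : ℝ) ^ n * 2 ^ e * (2 ^ (e ^ 2 + 4 * e + 3 * e * n) * P) := by gcongr
      _ = _ := by ring
  have hQP : 0 ≤ Q * P := by positivity
  have h2e : (1 : ℝ) ≤ 2 ^ e := one_le_pow₀ one_le_two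
  calc (F.card : ℝ) ≤ 32 * Q * P + 2 ^ e * Q * P := by linarith
    _ ≤ 2 ^ e * 64 * (Q * P) := by nlinarith
    _ = _ := by ring

end TupleCount

/-! ### From numbers with a subfield to tuples: the bound for `Z(e, n, X)`. -/

section WithSubfield

open NumberField

theorem finrank_adjoin_le_mul {M : IntermediateField ℚ Qbar} [FiniteDimensional ℚ M] {α : Qbar}
    {p : M[X]} (hp : p.Monic) (hα : aeval α p = 0) :
    Module.finrank ℚ ℚ⟮α⟯ ≤ Module.finrank ℚ M * p.natDegree := by
  have hint : IsIntegral M α := ⟨p, hp, hα⟩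
  have : FiniteDimensional M M⟮α⟯ := adjoin.finiteDimensional hint
  have : FiniteDimensional ℚ M⟮α⟯ := FiniteDimensional.trans ℚ M M⟮α⟯
  have : FiniteDimensional ℚ (restrictScalars ℚ M⟮α⟯) := this
  have hle : ℚ⟮α⟯ ≤ restrictScalars ℚ M⟮α⟯ :=
    adjoin_simple_le_iff.mpr (mem_adjoin_simple_self M α)
  calc _ ≤ Module.finrank ℚ (restrictScalars ℚ M⟮α⟯) := finrank_le_of_le_right hle
    _ = Module.finrank ℚ M * Module.finrank M M⟮α⟯ := (Module.finrank_mul_finrank ℚ M M⟮α⟯).symm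
    _ ≤ _ := Nat.mul_le_mul_left _ (by
      rw [adjoin.finrank hint]
      exact natDegree_le_of_dvd (minpoly.dvd M α hα) hp.ne_zero)

theorem monic_tuple {R : Type*} [CommRing R] [Nontrivial R] {n : ℕ} (c : Fin n → R) :
    (X ^ n + ∑ i : Fin n, C (c i) * X ^ (i : ℕ)).Monic ∧
      (X ^ n + ∑ i : Fin n, C (c i) * X ^ (i : ℕ)).natDegree = n := by
  have hlt : (∑ i : Fin n, C (c i) * X ^ (i : ℕ)).degree < (n : WithBot ℕ) :=
    mem_degreeLT.mp (Submodule.sum_mem _ fun i _ => mem_degreeLT.mpr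
      ((degree_C_mul_X_pow_le _ _).trans_lt (by exact_mod_cast i.2)))
  refine ⟨monic_X_pow_add hlt, natDegree_eq_of_degree_eq_some ?_⟩
  rw [degree_add_eq_left_of_degree_lt (by rwa [degree_X_pow]), degree_X_pow]

theorem adjoin_simple_gen_eq_top (K : Type*) [Field K] [Algebra ℚ K] (α : Qbar) [Algebra K ℚ⟮α⟯]
    [IsScalarTower ℚ K ℚ⟮α⟯] : K⟮AdjoinSimple.gen ℚ α⟯ = ⊤ := by
  rw [eq_top_iff]
  rintro y -
  obtain ⟨f, hf⟩ :=
    (adjoin.powerBasis (Algebra.IsIntegral.isIntegral (R := ℚ) α)).exists_eq_aeval' y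
  rw [adjoin.powerBasis_gen, ← aeval_map_algebraMap K] at hf
  rw [hf]
  exact algebra_adjoin_le_adjoin K _ (aeval_mem_adjoin_singleton K _)

theorem exists_tuple {e n : ℕ} (hn : 0 < n) {α : Qbar} (hα : Module.finrank ℚ ℚ⟮α⟯ = e * n)
    {K : IntermediateField ℚ Qbar} (hK : K ≤ ℚ⟮α⟯) (hKe : Module.finrank ℚ K = e) :
    ∃ c : Fin n → Qbar, Module.finrank ℚ (tupleField c) = e ∧
      tupleHeight (tupleGen c) ≤ 2 ^ (n * e) * NumberField.absMulHeight₁ α ^ (e * n) ∧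
      (X ^ n + ∑ i : Fin n, C (c i) * X ^ (i : ℕ)).IsRoot α := by
  let : Algebra K ℚ⟮α⟯ := (inclusion hK).toRingHom.toAlgebra
  have : IsScalarTower K ℚ⟮α⟯ Qbar := IsScalarTower.of_algebraMap_eq fun _ => rfl
  have : IsScalarTower ℚ K ℚ⟮α⟯ := IsScalarTower.of_algebraMap_eq fun _ => rfl
  have : FiniteDimensional ℚ K := FiniteDimensional.left ℚ K ℚ⟮α⟯
  have : FiniteDimensional K ℚ⟮α⟯ := FiniteDimensional.right ℚ K ℚ⟮α⟯
  have : NumberField K := { to_finiteDimensional := inferInstance }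
  have he : 0 < e := hKe ▸ Module.finrank_pos
  set g := AdjoinSimple.gen ℚ α
  have hint : IsIntegral K g := Algebra.IsIntegral.isIntegral g
  have htop : K⟮g⟯ = ⊤ := adjoin_simple_gen_eq_top K α
  have hdeg : (minpoly K g).natDegree = n := by
    rw [← adjoin.finrank hint, htop, finrank_top']
    have := Module.finrank_mul_finrank ℚ K ℚ⟮α⟯
    rw [hKe, hα] at this
    exact Nat.eq_of_mul_eq_mul_left he this
  have hheight := tupleHeight_minpoly_le htop hdeg
  rw [tupleHeight_gen, hKe, hα] at hheight
  have hmonic := minpoly.monic hint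
  let c : Fin n → Qbar := fun i => ((minpoly K g).coeff i : K)
  have hexp : ∀ (R : Type) [CommRing R] (q : R[X]), q.Monic → q.natDegree = n →
      q = X ^ n + ∑ i : Fin n, C (q.coeff i) * X ^ (i : ℕ) := by
    intro R _ q hq hqn
    rw [Fin.sum_univ_eq_sum_range fun i => C (q.coeff i) * X ^ i, ← hqn]
    exact hq.as_sum
  have hroot : (X ^ n + ∑ i : Fin n, C (c i) * X ^ (i : ℕ)).IsRoot α := by
    have h1 : ((minpoly K g).map (algebraMap K Qbar)).IsRoot α := by
      rw [IsRoot.def, eval_map_algebraMap]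
      have := congrArg (algebraMap ℚ⟮α⟯ Qbar) (minpoly.aeval K g)
      rw [← aeval_algebraMap_apply, map_zero] at this
      exact this
    rw [hexp _ _ (hmonic.map (algebraMap K Qbar)) (by rw [hmonic.natDegree_map, hdeg])] at h1
    simp only [coeff_map] at h1
    exact h1
  have hle : tupleField c ≤ K := by
    unfold tupleField
    rw [adjoin_le_iff]
    rintro _ ⟨i, rfl⟩
    exact ((minpoly K g).coeff i).2
  have hMK : tupleField c = K := by
    -- `α` is a root of a monic polynomial of degree `n` over the field of the coefficients, so that
    -- field has degree at least `en/n = e`.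
    refine eq_of_le_of_finrank_le hle ?_
    let p : (tupleField c)[X] := X ^ n + ∑ i : Fin n, C (tupleGen c i) * X ^ (i : ℕ)
    obtain ⟨hp, hpn⟩ := monic_tuple (tupleGen c)
    have h2 := finrank_adjoin_le_mul (α := α) hp (by
      have := hroot
      simp only [IsRoot.def, eval_add, eval_pow, eval_X, eval_finsetSum, eval_mul, eval_C] at this
      simp only [map_add, map_pow, aeval_X, map_sum, map_mul, aeval_C]
      exact this)
    rw [hpn, hα] at h2
    exact hKe.trans_le <| Nat.le_of_mul_le_mul_right h2 hn
  refine ⟨c, hMK ▸ hKe, ?_, hroot⟩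
  rw [tupleHeight_tupleGen hMK (c' := fun i => (minpoly K g).coeff i) fun _ => rfl]
  exact hheight

theorem card_numbersWithSubfield_le {e n : ℕ} (he : 0 < e) (hn : 0 < n) {T : ℝ} (hT : 1 ≤ T)
    (F : Finset Qbar) (hF : (F : Set Qbar) ⊆ numbersWithSubfield e n T) :
    (F.card : ℝ) ≤ (n * 2 ^ (e * (n ^ 2 + n * e + 2 * e + n + 13) + n ^ 2 + 10 * n)) *
      T ^ (e * n * (n + e)) := by
  classical
  -- For `e = 1` the dyadic sum would diverge, but counting minimal polynomials over `ℤ` already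
  -- gives the exponent `n(n+1)`.
  rcases (show e = 1 ∨ 2 ≤ e by omega) with rfl | he2
  · have h := card_numberMahler_le (d := n) (one_le_pow₀ hT (n := n)) F fun α hα => by
      obtain ⟨h1, -, h2⟩ := hF hα
      rw [one_mul] at h1
      refine ⟨h1, (numberMahler_le_absMulHeight₁_pow α).trans ?_⟩
      rw [h1]
      exact pow_le_pow_left₀ (zero_le_one.trans (one_le_absMulHeight₁ α)) h2 n
    calc (F.card : ℝ) ≤ n * (2 ^ (n + 2) * T ^ n) ^ (n + 1) := h
      _ = (n * 2 ^ ((n + 2) * (n + 1))) * T ^ (1 * n * (n + 1)) := by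
          rw [mul_pow, ← pow_mul, ← pow_mul, one_mul, mul_assoc]
      _ ≤ _ := by
          gcongr
          · exact one_le_two
          · nlinarith
  have hex : ∀ α ∈ F, ∃ c : Fin n → Qbar, Module.finrank ℚ (tupleField c) = e ∧
      tupleHeight (tupleGen c) ≤ (2 ^ n * T ^ n) ^ e ∧
      (X ^ n + ∑ i : Fin n, C (c i) * X ^ (i : ℕ)).IsRoot α := by
    intro α hα
    obtain ⟨h1, ⟨K, hK, hKe⟩, h2⟩ := hF hα
    obtain ⟨c, hc1, hc2, hc3⟩ := exists_tuple hn h1 hK hKe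
    refine ⟨c, hc1, hc2.trans ?_, hc3⟩
    have h3 := one_le_absMulHeight₁ α
    rw [mul_pow, ← pow_mul, ← pow_mul, mul_comm e n]
    gcongr
  choose! f hf1 hf2 hf3 using hex
  have h1 := card_le_sum_image F f (fun _ => (n : ℝ)) fun α hα => by
    have h2 := card_root_fiber_le F
      (fun c : Fin n → Qbar => X ^ n + ∑ i : Fin n, C (c i) * X ^ (i : ℕ)) (f := f)
      (fun x hx => ⟨(monic_tuple (f x)).1.ne_zero, hf3 x hx⟩) hα
    rw [(monic_tuple (f α)).2] at h2
    exact_mod_cast h2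
  rw [Finset.sum_const, nsmul_eq_mul] at h1
  have hY : 1 ≤ 2 ^ n * T ^ n :=
    one_le_mul_of_one_le_of_one_le (one_le_pow₀ one_le_two) (one_le_pow₀ hT)
  have h3 := card_tuples_generating_le he2 hY (F.image f) fun c hc => by
    obtain ⟨α, hα, rfl⟩ := Finset.mem_image.mp hc
    exact ⟨hf1 α hα, hf2 α hα⟩
  calc (F.card : ℝ) ≤ 2 ^ (e ^ 2 + 5 * e + n + 3 * e * n + 6) *
          ((2 ^ n * T ^ n) ^ e) ^ (n + e) * n :=
        h1.trans (mul_le_mul_of_nonneg_right h3 (Nat.cast_nonneg n))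
    _ = (n * 2 ^ (e ^ 2 + 5 * e + n + 3 * e * n + 6 + n * e * (n + e))) *
          T ^ (e * n * (n + e)) := by
        rw [pow_add 2 _ (n * e * (n + e)), pow_mul _ (n * e), pow_mul _ n e, mul_comm e n,
          pow_mul _ (n * e), pow_mul _ n e, mul_pow (2 ^ n), mul_pow ((2 ^ n) ^ e)]
        ring
    _ ≤ _ := by
        -- The right side minus the left is `(e - n)^2 + 8e + 9n - 6`.
        have hexp : e ^ 2 + 5 * e + n + 3 * e * n + 6 + n * e * (n + e) ≤
            e * (n ^ 2 + n * e + 2 * e + n + 13) + n ^ 2 + 10 * n := by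
          zify
          nlinarith [sq_nonneg ((e : ℤ) - n)]
        gcongr
        exact one_le_two

theorem numbersWithSubfield_finite_and_ncard_le {e n : ℕ} (he : 0 < e) (hn : 0 < n) {T : ℝ}
    (hT : 0 < T) : (numbersWithSubfield e n T).Finite ∧
      ((numbersWithSubfield e n T).ncard : ℝ) ≤
        (n * 2 ^ (e * (n ^ 2 + n * e + 2 * e + n + 13) + n ^ 2 + 10 * n)) *
          T ^ (e * n * (n + e)) := by
  refine finite_and_ncard_le fun F hF => ?_
  rcases le_or_gt 1 T with h1 | h1
  · exact card_numbersWithSubfield_le he hn h1 F hF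
  · have hF0 : F = ∅ := Finset.eq_empty_of_forall_notMem fun α hα =>
      (((one_le_absMulHeight₁ α).trans (hF hα).2.2).trans_lt h1).false
    rw [hF0, Finset.card_empty, Nat.cast_zero]
    positivity

end WithSubfield

/-! ### The Weil height is bounded by the naive height. -/

section NaiveHeight

open NumberField

/-- The inverse of `s` is a root of the reversed polynomial, whose leading coefficient is the
constant term of `P` when that is nonzero. -/
theorem isIntegral_coeff_zero_div {L : Type*} [Field L] {P : ℤ[X]} {s : L}
    (hs : aeval s P = 0) : IsIntegral ℤ ((P.coeff 0 : L) / s) := by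
  rcases eq_or_ne s 0 with rfl | hs0
  · simpa using isIntegral_zero
  rcases eq_or_ne (P.coeff 0) 0 with h0 | h0
  · simpa [h0] using isIntegral_zero
  let : Invertible s := invertibleOfNonzero hs0
  have h1 : aeval s⁻¹ P.reverse = 0 := by
    have := (eval₂_reverse_eq_zero_iff (algebraMap ℤ L) s P).mpr hs
    rwa [invOf_eq_inv] at this
  have h2 := isIntegral_leadingCoeff_smul P.reverse s⁻¹ h1
  rwa [reverse_leadingCoeff, trailingCoeff_eq_coeff_zero h0, zsmul_eq_mul, ← div_eq_mul_inv] at h2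

theorem dvd_gcd_pow {ι : Type*} (s : Finset ι) (f : ι → ℕ) {N a k : ℕ} (hk : k ≠ 0)
    (h : ∀ i ∈ s, N ∣ a * f i ^ k) : N ∣ a * s.gcd f ^ k := by
  classical
  induction s using Finset.induction_on with
  | empty => simp [hk]
  | insert i s _ ih =>
    rw [Finset.gcd_insert]
    have h1 : gcd (f i) (s.gcd f) ^ k = Nat.gcd (f i ^ k) (s.gcd f ^ k) :=
      Nat.pow_gcd_pow.symm
    rw [h1, ← Nat.gcd_mul_left]
    exact Nat.dvd_gcd (h i (Finset.mem_insert_self i s))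
      (ih fun j hj => h j (Finset.mem_insert_of_mem hj))

/-- The absolute value of the Vandermonde determinant of `0, 1, …, d`. -/
def vandermondeConst (d : ℕ) : ℕ :=
  (Matrix.vandermonde fun i : Fin (d + 1) => ((i : ℕ) : ℤ)).det.natAbs

theorem vandermondeConst_pos (d : ℕ) : 0 < vandermondeConst d := by
  refine Int.natAbs_pos.mpr (Matrix.det_vandermonde_ne_zero_iff.mpr fun i j h => ?_)
  exact Fin.ext (by exact_mod_cast h)

/-- The adjugate of the Vandermonde matrix recovers the determinant times each coefficient from the
values at `0, …, d`. A common divisor of the values thus divides the determinant times the content,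
and the content is 1. -/
theorem gcd_eval_dvd_vandermondeConst {D : ℤ[X]} (hD : D.IsPrimitive) {d : ℕ}
    (hd : D.natDegree = d) :
    (Finset.univ.gcd fun t : Fin (d + 1) => (D.eval ((t : ℕ) : ℤ)).natAbs) ∣
      vandermondeConst d := by
  set G := Finset.univ.gcd fun t : Fin (d + 1) => (D.eval ((t : ℕ) : ℤ)).natAbs
  set V := Matrix.vandermonde fun i : Fin (d + 1) => ((i : ℕ) : ℤ) with hV
  let a : Fin (d + 1) → ℤ := fun i => D.coeff i
  have hVa : V.mulVec a = fun t : Fin (d + 1) => D.eval ((t : ℕ) : ℤ) := by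
    funext t
    rw [eval_eq_sum_range, hd, ← Fin.sum_univ_eq_sum_range fun i => D.coeff i * ((t : ℕ) : ℤ) ^ i]
    simp only [Matrix.mulVec, dotProduct]
    exact Finset.sum_congr rfl fun i _ => mul_comm (((t : ℕ) : ℤ) ^ (i : ℕ)) (D.coeff i)
  have h1 : ∀ i, (G : ℤ) ∣ V.det * D.coeff i := by
    intro i
    rcases lt_or_ge i (d + 1) with hi | hi
    · have h2 : V.adjugate.mulVec (V.mulVec a) = V.det • a := by
        rw [Matrix.mulVec_mulVec, Matrix.adjugate_mul, Matrix.smul_mulVec, Matrix.one_mulVec]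
      have h3 := congrFun h2 ⟨i, hi⟩
      rw [Pi.smul_apply, smul_eq_mul] at h3
      rw [← h3, hVa]
      simp only [Matrix.mulVec, dotProduct]
      refine Finset.dvd_sum fun t _ => Dvd.dvd.mul_left ?_ (V.adjugate ⟨i, hi⟩ t)
      exact Int.natCast_dvd.mpr (Finset.gcd_dvd (Finset.mem_univ t))
    · rw [coeff_eq_zero_of_natDegree_lt (by omega), mul_zero]
      exact dvd_zero _
  have h2 : (G : ℤ) ∣ (C V.det * D).content :=
    dvd_content_iff_C_dvd.mpr ((C_dvd_iff_dvd_coeff _ _).mpr fun i => by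
      rw [coeff_C_mul]
      exact h1 i)
  rw [content_C_mul, hD.content_eq_one, mul_one] at h2
  exact Int.natCast_dvd.mp (h2.trans (normalize_associated V.det).dvd)

theorem map_intMinpoly_eq_prod (α : Qbar) :
    (intMinpoly α).map (Int.castRingHom ℂ) = C ((intMinpoly α).leadingCoeff : ℂ) *
      ∏ σ : ℚ⟮α⟯ →+* ℂ, (X - C (σ (AdjoinSimple.gen ℚ α))) := by
  set g := AdjoinSimple.gen ℚ α
  have hmin : minpoly ℚ g = minpoly ℚ α := minpoly_gen ℚ α
  have htop : ℚ⟮g⟯ = ⊤ := adjoin_simple_gen_eq_top ℚ α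
  rw [prod_ringHom_eq_prod_algHom (fun σ : ℚ⟮α⟯ →+* ℂ => X - C (σ g))]
  refine Eq.trans ?_ (congrArg _ (prod_X_sub_C_embeddings (K := ℚ) (Ω := ℂ) g).symm)
  rw [htop, IntermediateField.finrank_top, pow_one, hmin]
  have : Int.castRingHom ℂ = (algebraMap ℚ ℂ).comp (Int.castRingHom ℚ) := RingHom.ext_int _ _
  rw [this, ← Polynomial.map_map, (intMinpoly_spec α).2.2, Polynomial.map_mul, map_C]
  simp

theorem numberMahler_eq (α : Qbar) : numberMahler α = (intMinpoly α).leadingCoeff.natAbs *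
    ∏ σ : ℚ⟮α⟯ →+* ℂ, max 1 ‖σ (AdjoinSimple.gen ℚ α)‖ := by
  rw [numberMahler, map_intMinpoly_eq_prod, mahlerMeasure_mul, mahlerMeasure_const,
    mahlerMeasure_prod_X_sub_C, Complex.norm_intCast, Nat.cast_natAbs, Int.cast_abs]

theorem numberMahler_le_naiveHeight (α : Qbar) :
    numberMahler α ≤ √(Module.finrank ℚ ℚ⟮α⟯ + 1) * naiveHeight α := by
  refine (mahlerMeasure_le_sqrt_natDegree_add_one_mul_supNorm _).trans ?_
  rw [natDegree_map_eq_of_injective (RingHom.injective_int (Int.castRingHom ℂ)),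
    natDegree_intMinpoly]
  refine mul_le_mul_of_nonneg_left ?_ (Real.sqrt_nonneg _)
  obtain ⟨i, hi⟩ := ((intMinpoly α).map (Int.castRingHom ℂ)).exists_eq_supNorm
  rw [hi, coeff_map, eq_intCast, Complex.norm_intCast, ← Int.norm_eq_abs]
  exact le_supNorm _ i

/-- With `w = D(t)`, the number `w/(t - α)` is an integral denominator of `α`. Since `w = a ∏ (t - σ
α)`, its norm is `a w^(d-1)` up to sign. -/
theorem absNorm_denomIdeal_dvd {α : Qbar} (hd : 2 ≤ Module.finrank ℚ ℚ⟮α⟯) (t : ℤ) :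
    Ideal.absNorm (denomIdeal fun _ : Unit => AdjoinSimple.gen ℚ α) ∣
      (intMinpoly α).leadingCoeff.natAbs *
        ((intMinpoly α).eval t).natAbs ^ (Module.finrank ℚ ℚ⟮α⟯ - 1) := by
  set D := intMinpoly α with hD
  set g := AdjoinSimple.gen ℚ α with hg
  set a := D.leadingCoeff
  set w := D.eval t with hw
  -- If `w = 0` the right side vanishes, as the exponent `d - 1` is positive.
  rcases eq_or_ne w 0 with h0 | h0
  · rw [h0, Int.natAbs_zero, zero_pow (by omega), mul_zero]
    exact dvd_zero _
  have haeval : aeval g D = 0 := by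
    apply (algebraMap ℚ⟮α⟯ Qbar).injective
    rw [← aeval_algebraMap_apply, map_zero]
    exact aeval_intMinpoly α
  have hs0 : (t : ℚ⟮α⟯) - g ≠ 0 := by
    intro h
    rw [sub_eq_zero] at h
    rw [← h, aeval_def, eval₂_at_intCast, eq_intCast, Int.cast_eq_zero] at haeval
    exact h0 haeval
  have hint : IsIntegral ℤ ((w : ℚ⟮α⟯) / (t - g)) := by
    -- `D(t - X)` has root `t - α` and constant term `D(t) = w`.
    have h1 : aeval ((t : ℚ⟮α⟯) - g) (D.comp (C t - X)) = 0 := by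
      rw [aeval_comp, map_sub, aeval_C, aeval_X, eq_intCast (algebraMap ℤ ℚ⟮α⟯), sub_sub_cancel,
        haeval]
    have h2 := isIntegral_coeff_zero_div h1
    rwa [coeff_zero_eq_eval_zero, eval_comp, eval_sub, eval_C, eval_X, sub_zero] at h2
  let r : 𝓞 ℚ⟮α⟯ := ⟨_, hint⟩
  have hr : r ∈ denomIdeal fun _ : Unit => g := by
    rintro -
    have h1 : (w : ℚ⟮α⟯) / (t - g) * g = t * ((w : ℚ⟮α⟯) / (t - g)) - w := by
      field_simp
      ring
    change IsIntegral ℤ ((w : ℚ⟮α⟯) / (t - g) * g)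
    rw [h1]
    exact ((isIntegral_algebraMap (R := ℤ) (x := t)).mul hint).sub
      (isIntegral_algebraMap (R := ℤ) (x := w))
  refine (Ideal.absNorm_dvd_absNorm_of_le
    ((Ideal.span_singleton_le_iff_mem _).mpr hr)).trans (dvd_of_eq ?_)
  have hprod : (a.natAbs : ℝ) * ∏ σ : ℚ⟮α⟯ →+* ℂ, ‖σ (t - g)‖ = w.natAbs := by
    have h1 := congrArg (fun P : ℂ[X] => ‖P.eval (t : ℂ)‖) (map_intMinpoly_eq_prod α)
    simp only [eval_mul, eval_C, eval_prod, eval_sub, eval_X, norm_mul, norm_prod] at h1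
    rw [eval_intCast_map, eq_intCast, Complex.norm_intCast, Complex.norm_intCast, ← hD,
      Int.cast_id, ← hw, ← Int.cast_abs, ← Int.cast_abs, ← Nat.cast_natAbs, ← Nat.cast_natAbs] at h1
    rw [h1]
    congr 1
    refine Finset.prod_congr rfl fun σ _ => ?_
    rw [map_sub, map_intCast]
  have hw0 : (w.natAbs : ℝ) ≠ 0 := by exact_mod_cast Int.natAbs_ne_zero.mpr h0
  have hcard : Fintype.card (ℚ⟮α⟯ →+* ℂ) = Module.finrank ℚ ℚ⟮α⟯ := Embeddings.card _ ℂ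
  have hd0 : 0 < Module.finrank ℚ ℚ⟮α⟯ := Module.finrank_pos
  have hmain : (Ideal.absNorm (Ideal.span {r}) : ℝ) * w.natAbs =
      (a.natAbs * w.natAbs ^ (Module.finrank ℚ ℚ⟮α⟯ - 1) : ℕ) * w.natAbs := by
    rw [← prod_norm_embeddings_int, ← hprod]
    have h1 : ∀ σ : ℚ⟮α⟯ →+* ℂ, ‖σ r‖ * ‖σ (t - g)‖ = w.natAbs := by
      intro σ
      rw [← norm_mul, ← map_mul]
      change ‖σ ((w : ℚ⟮α⟯) / (t - g) * (t - g))‖ = _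
      rw [div_mul_cancel₀ _ hs0, map_intCast, Complex.norm_intCast, ← Int.cast_abs,
        ← Nat.cast_natAbs]
    rw [mul_left_comm, ← Finset.prod_mul_distrib, Finset.prod_congr rfl fun σ _ => h1 σ,
      Finset.prod_const, Finset.card_univ, hcard, hprod]
    push_cast
    rw [mul_assoc, pow_sub_one_mul hd0.ne']
  exact_mod_cast mul_right_cancel₀ hw0 hmain

/-- Taking the gcd over `t = 0, …, d` in `absNorm_denomIdeal_dvd` bounds the finite part of the
height by the leading coefficient times a constant depending only on `d`. What remains is the Mahler
measure, at most `√(d+1)` times the naive height. -/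
theorem absMulHeight₁_pow_le_naiveHeight {α : Qbar} (hd : 2 ≤ Module.finrank ℚ ℚ⟮α⟯) :
    NumberField.absMulHeight₁ α ^ Module.finrank ℚ ℚ⟮α⟯ ≤
      vandermondeConst (Module.finrank ℚ ℚ⟮α⟯) ^ (Module.finrank ℚ ℚ⟮α⟯ - 1) *
        (√(Module.finrank ℚ ℚ⟮α⟯ + 1) * naiveHeight α) := by
  set d := Module.finrank ℚ ℚ⟮α⟯
  have h1 : Ideal.absNorm (denomIdeal fun _ : Unit => AdjoinSimple.gen ℚ α) ∣
      (intMinpoly α).leadingCoeff.natAbs * vandermondeConst d ^ (d - 1) :=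
    (dvd_gcd_pow Finset.univ
      (fun t : Fin (d + 1) => ((intMinpoly α).eval ((t : ℕ) : ℤ)).natAbs) (by omega)
      fun t _ => absNorm_denomIdeal_dvd hd _).trans (mul_dvd_mul_left _ (pow_dvd_pow_of_dvd
        (gcd_eval_dvd_vandermondeConst (intMinpoly_spec α).1 (natDegree_intMinpoly α)) _))
  have h2 := Nat.le_of_dvd (Nat.mul_pos
    (Int.natAbs_pos.mpr (intMinpoly_spec α).2.1.ne') (Nat.pow_pos (vandermondeConst_pos d))) h1
  rw [← tupleHeight_gen, tupleHeight]
  calc _ ≤ (((intMinpoly α).leadingCoeff.natAbs * vandermondeConst d ^ (d - 1) : ℕ) : ℝ) *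
        ∏ σ : ℚ⟮α⟯ →+* ℂ, max 1 ‖σ (AdjoinSimple.gen ℚ α)‖ := by
        refine mul_le_mul (Nat.cast_le.mpr h2) (Finset.prod_le_prod
          (fun σ _ => (archSize_pos _ σ).le) fun σ _ => archSize_le (le_max_left _ _)
          fun _ => le_max_right _ _) (Finset.prod_nonneg fun σ _ => (archSize_pos _ σ).le)
          (Nat.cast_nonneg _)
    _ = vandermondeConst d ^ (d - 1) * numberMahler α := by
        rw [numberMahler_eq]
        push_cast
        ring
    _ ≤ _ := mul_le_mul_of_nonneg_left (numberMahler_le_naiveHeight α) (by positivity)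

end NaiveHeight

/-! ### Upper bound for fields with a nontrivial subfield. -/

section FieldsWithSubfield

theorem exists_naiveHeight_eq_natCast (α : Qbar) : ∃ m : ℕ, naiveHeight α = m := by
  obtain ⟨i, hi⟩ := (intMinpoly α).exists_eq_supNorm
  refine ⟨((intMinpoly α).coeff i).natAbs, ?_⟩
  rw [naiveHeight, hi, Int.norm_eq_abs, Nat.cast_natAbs, Int.cast_abs]

theorem exists_generator_naiveHeight_eq (L : IntermediateField ℚ Qbar) [FiniteDimensional ℚ L] :
    ∃ α : Qbar, ℚ⟮α⟯ = L ∧ naiveHeight α = fieldPi L := by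
  classical
  have hne : ∃ m : ℕ, ∃ α : Qbar, ℚ⟮α⟯ = L ∧ naiveHeight α = m := by
    obtain ⟨a, ha⟩ := Field.exists_primitive_element ℚ L
    obtain ⟨m, hm⟩ := exists_naiveHeight_eq_natCast a
    refine ⟨m, a, ?_, hm⟩
    exact (lift_adjoin_simple ℚ L a).symm.trans ((congrArg lift ha).trans (lift_top ℚ L))
  obtain ⟨α, hα, hm⟩ := Nat.find_spec hne
  refine ⟨α, hα, ?_⟩
  symm
  refine IsLeast.csInf_eq ⟨⟨α, hα, rfl⟩, ?_⟩
  rintro _ ⟨β, hβ, rfl⟩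
  obtain ⟨k, hk⟩ := exists_naiveHeight_eq_natCast β
  rw [hm, hk]
  exact_mod_cast Nat.find_min' hne ⟨β, hβ, hk⟩

theorem fieldPi_le_naiveHeight (α : Qbar) : fieldPi ℚ⟮α⟯ ≤ naiveHeight α :=
  csInf_le ⟨0, by rintro _ ⟨β, -, rfl⟩; exact supNorm_nonneg _⟩ ⟨α, rfl, rfl⟩

theorem finiteDimensional_of_mem_fieldsOfDegree {d : ℕ} (hd : 0 < d) {X : ℝ}
    {L : IntermediateField ℚ Qbar} (hL : L ∈ fieldsOfDegree d X) : FiniteDimensional ℚ L :=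
  Module.finite_of_finrank_pos (hL.1 ▸ hd)

theorem exists_generator_of_mem_fieldsOfDegree {d : ℕ} (hd : 0 < d) {X : ℝ}
    {L : IntermediateField ℚ Qbar} (hL : L ∈ fieldsOfDegree d X) :
    ∃ α : Qbar, ℚ⟮α⟯ = L ∧ naiveHeight α ≤ X := by
  have := finiteDimensional_of_mem_fieldsOfDegree hd hL
  obtain ⟨α, hα, h⟩ := exists_generator_naiveHeight_eq L
  exact ⟨α, hα, h.trans_le hL.2⟩

theorem fieldsOfDegree_finite {d : ℕ} (hd : 0 < d) (X : ℝ) : (fieldsOfDegree d X).Finite := by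
  have hfin : {α : Qbar | Module.finrank ℚ ℚ⟮α⟯ = d ∧ naiveHeight α ≤ X}.Finite := by
    refine (finite_and_ncard_le (C := d * (2 ^ (d + 2) * max 1 (√(d + 1) * X)) ^ (d + 1))
      fun F hF => card_numberMahler_le (le_max_left _ _) F fun α hα => ?_).1
    obtain ⟨h1, h2⟩ := hF hα
    refine ⟨h1, (numberMahler_le_naiveHeight α).trans (le_max_of_le_right ?_)⟩
    rw [h1]
    gcongr
  refine (hfin.image fun α => ℚ⟮α⟯).subset fun L hL => ?_
  obtain ⟨α, hα, h⟩ := exists_generator_of_mem_fieldsOfDegree hd hL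
  exact ⟨α, ⟨hα ▸ hL.1, h⟩, hα⟩

/-- A generator of least naive height has `H^d ≤ B X`, so part (1) with `T^d = B X` gives `(B
X)^(n+e)` for each factorization `d = en`. -/
theorem exists_ncard_fieldsWithSubfield_le {d : ℕ} (hd : 6 < d) :
    ∃ C : ℝ, ∀ X : ℝ, 1 ≤ X → ((fieldsWithSubfield d X).ncard : ℝ) ≤ C * X ^ (d - 2) := by
  classical
  set B : ℝ := vandermondeConst d ^ (d - 1) * √(d + 1) with hB
  have hB1 : 1 ≤ B := by
    refine one_le_mul_of_one_le_of_one_le (one_le_pow₀ ?_) ?_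
    · exact_mod_cast vandermondeConst_pos d
    · exact Real.one_le_sqrt.mpr (by linarith [Nat.cast_nonneg (α := ℝ) d])
  let c : ℕ → ℝ := fun e => ((d / e : ℕ) *
    2 ^ (e * ((d / e) ^ 2 + (d / e) * e + 2 * e + d / e + 13) +
    (d / e) ^ 2 + 10 * (d / e)))
  let E : Finset ℕ := d.properDivisors.erase 1
  refine ⟨∑ e ∈ E, c e * B ^ (d - 2), fun X hX => ?_⟩
  set T : ℝ := (B * X) ^ ((d : ℝ)⁻¹) with hT
  have hBX : 1 ≤ B * X := one_le_mul_of_one_le_of_one_le hB1 hX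
  have hTd : T ^ d = B * X := Real.rpow_inv_natCast_pow (by linarith) (by omega)
  have hT0 : 0 < T := Real.rpow_pos_of_pos (by linarith) _
  have hEmem : ∀ e ∈ E, 2 ≤ e ∧ 2 ≤ d / e ∧ e * (d / e) = d := by
    intro e he
    obtain ⟨he1, he2⟩ := Finset.mem_erase.mp he
    obtain ⟨⟨n, hn⟩, hlt⟩ := Nat.mem_properDivisors.mp he2
    have he0 : 0 < e := by
      rcases Nat.eq_zero_or_pos e with h | h
      · subst h
        omega
      · exact h
    have hdn : d / e = n := by rw [hn, Nat.mul_div_cancel_left n he0]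
    rw [hdn]
    refine ⟨by omega, ?_, hn.symm⟩
    by_contra h
    have : n ≤ 1 := by omega
    nlinarith
  have hsub : fieldsWithSubfield d X ⊆
      ⋃ e ∈ E, (fun α => ℚ⟮α⟯) '' numbersWithSubfield e (d / e) T := by
    rintro L ⟨hL, K, hKL, hK0, hK1⟩
    have := finiteDimensional_of_mem_fieldsOfDegree (by omega) hL
    obtain ⟨α, hα, hh⟩ := exists_generator_of_mem_fieldsOfDegree (by omega) hL
    have hdvd : Module.finrank ℚ K ∣ d := hL.1 ▸ finrank_dvd_of_le_right hKL
    have hne : Module.finrank ℚ K ≠ d := fun h =>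
      hK1 (eq_of_le_of_finrank_eq hKL (h.trans hL.1.symm))
    have hne1 : Module.finrank ℚ K ≠ 1 := fun h => hK0 (finrank_eq_one_iff.mp h)
    have hE : Module.finrank ℚ K ∈ E := Finset.mem_erase.mpr ⟨hne1, Nat.mem_properDivisors.mpr
      ⟨hdvd, lt_of_le_of_ne (Nat.le_of_dvd (by omega) hdvd) hne⟩⟩
    refine Set.mem_biUnion hE ⟨α, ⟨?_, ⟨K, hα ▸ hKL, rfl⟩, ?_⟩, hα⟩
    · rw [(hEmem _ hE).2.2, hα, hL.1]
    · have hαd : Module.finrank ℚ ℚ⟮α⟯ = d := hα ▸ hL.1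
      have h1 := absMulHeight₁_pow_le_naiveHeight (α := α) (by omega)
      rw [hαd, ← mul_assoc, ← hB] at h1
      refine le_of_pow_le_pow_left₀ (n := d) (by omega) hT0.le ?_
      rw [hTd]
      exact h1.trans (mul_le_mul_of_nonneg_left hh (by linarith))
  have hcount : ∀ e ∈ E, (((fun α => ℚ⟮α⟯) '' numbersWithSubfield e (d / e) T).ncard : ℝ) ≤
      c e * B ^ (d - 2) * X ^ (d - 2) := by
    intro e he
    obtain ⟨h1, h2, h3⟩ := hEmem e he
    obtain ⟨hf, hc⟩ := numbersWithSubfield_finite_and_ncard_le (e := e) (n := d / e)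
      (by omega) (by omega) hT0
    have h4 : (((fun α => ℚ⟮α⟯) '' numbersWithSubfield e (d / e) T).ncard : ℝ) ≤
        ((numbersWithSubfield e (d / e) T).ncard : ℝ) := by
      exact_mod_cast Set.ncard_image_le hf
    refine (h4.trans hc).trans ?_
    -- With `n = d/e` this is `(e-1)(n-1) ≥ 3`, true for `e, n ≥ 2` unless `e = n = 2`, or one is 2
    -- and the other 3 with `(e-1)(n-1) = 2`; `d > 6` rules these out.
    have h5 : d / e + e ≤ d - 2 := by
      have h6 : d / e + e + 2 ≤ e * (d / e) := by
        rcases (show e = 2 ∨ 3 ≤ e by omega) with h | h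
        · rw [h] at h3 ⊢
          omega
        · rcases (show d / e = 2 ∨ 3 ≤ d / e by omega) with h' | h'
          · rw [h'] at h3 ⊢
            omega
          · nlinarith
      omega
    change c e * T ^ _ ≤ _
    rw [h3, pow_mul, hTd, mul_assoc (c e), ← mul_pow]
    exact mul_le_mul_of_nonneg_left (pow_le_pow_right₀ hBX h5) (by positivity)
  have hfin : ∀ e ∈ E, ((fun α => ℚ⟮α⟯) '' numbersWithSubfield e (d / e) T).Finite := by
    intro e he
    obtain ⟨h1, h2, -⟩ := hEmem e he
    exact (numbersWithSubfield_finite_and_ncard_le (by omega) (by omega) hT0).1.image _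
  calc ((fieldsWithSubfield d X).ncard : ℝ) ≤
        ((⋃ e ∈ E, (fun α => ℚ⟮α⟯) '' numbersWithSubfield e (d / e) T).ncard : ℝ) := by
        exact_mod_cast Set.ncard_le_ncard hsub (Set.Finite.biUnion E.finite_toSet hfin)
    _ ≤ ∑ e ∈ E, (((fun α => ℚ⟮α⟯) '' numbersWithSubfield e (d / e) T).ncard : ℝ) := by
        exact_mod_cast Finset.set_ncard_biUnion_le E _
    _ ≤ ∑ e ∈ E, c e * B ^ (d - 2) * X ^ (d - 2) := Finset.sum_le_sum hcount
    _ = _ := by rw [Finset.sum_mul]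

end FieldsWithSubfield

/-! ### Algebraic integers of bounded height in a fixed field. -/

section IntegerCount

open NumberField

variable {K : Type*} [Field K] [NumberField K]

/-- The region is covered by dyadic boxes, at most `log₂ R + 1` sizes per embedding. Rounding costs
`2^e`, so `card_box_le` for the unit ideal gives at most `12^e R` points in each. -/
theorem card_integers_le {R : ℝ} (hR : 1 ≤ R) (F : Finset K)
    (hF : ∀ x ∈ F, IsIntegral ℤ x ∧ ∏ σ : K →+* ℂ, max 1 ‖σ x‖ ≤ R) :
    (F.card : ℝ) ≤ ((Nat.log 2 ⌊R⌋₊ + 1 : ℕ) : ℝ) ^ Module.finrank ℚ K *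
      (12 ^ Module.finrank ℚ K * R) := by
  classical
  set e := Module.finrank ℚ K
  have hcard : Fintype.card (K →+* ℂ) = e := Embeddings.card K ℂ
  let f : K → (K →+* ℂ) → ℕ := fun x σ => Nat.log 2 ⌊max 1 ‖σ x‖⌋₊
  have hlow : ∀ x σ, (2 : ℝ) ^ f x σ ≤ max 1 ‖σ x‖ := by
    intro x σ
    have h1 : ⌊max 1 ‖σ x‖⌋₊ ≠ 0 := (Nat.floor_pos.mpr (le_max_left _ _)).ne'
    calc (2 : ℝ) ^ f x σ ≤ ⌊max 1 ‖σ x‖⌋₊ := by exact_mod_cast Nat.pow_log_le_self 2 h1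
      _ ≤ _ := Nat.floor_le (by positivity)
  have hup : ∀ x σ, max 1 ‖σ x‖ ≤ 2 ^ (f x σ + 1) := by
    intro x σ
    have h1 : ⌊max 1 ‖σ x‖⌋₊ + 1 ≤ 2 ^ (f x σ + 1) :=
      Nat.lt_pow_succ_log_self one_lt_two _
    calc max 1 ‖σ x‖ ≤ ⌊max 1 ‖σ x‖⌋₊ + 1 := (Nat.lt_floor_add_one _).le
      _ ≤ _ := by exact_mod_cast h1
  have h1 := card_le_sum_image F f (fun _ => 12 ^ e * R) (by
    intro x hx
    have hprod : ∏ σ : K →+* ℂ, (2 : ℝ) ^ (f x σ + 1) ≤ 2 ^ e * R := by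
      simp only [pow_succ]
      rw [Finset.prod_mul_distrib, Finset.prod_const, Finset.card_univ, hcard, mul_comm]
      refine mul_le_mul_of_nonneg_left ?_ (by positivity)
      exact (Finset.prod_le_prod (fun _ _ => by positivity) fun σ _ => hlow x σ).trans (hF x hx).2
    have h2 := card_box_le (K := K) (I := ⊤) top_ne_bot (fun σ => 2 ^ (f x σ + 1))
      (fun σ => by positivity) (fun σ => by
        simp only [f, ComplexEmbedding.conjugate_coe_eq, RCLike.norm_conj]) (by
        rw [Ideal.absNorm_top, Nat.cast_one, one_mul]
        exact Finset.one_le_prod fun σ _ => one_le_pow₀ one_le_two)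
      (F.filter fun y => f y = f x) (by
        intro y hy
        obtain ⟨hyF, hyf⟩ := Finset.mem_filter.mp hy
        refine ⟨fun r _ => r.isIntegral_coe.mul (hF y hyF).1, fun σ => ?_⟩
        rw [← hyf]
        exact (le_max_right _ _).trans (hup y σ))
    rw [Ideal.absNorm_top, Nat.cast_one, one_mul] at h2
    refine h2.trans ((mul_le_mul_of_nonneg_left hprod (by positivity)).trans_eq ?_)
    rw [← mul_assoc, ← mul_pow, show (6 : ℝ) * 2 = 12 by norm_num])
  rw [Finset.sum_const, nsmul_eq_mul] at h1
  refine h1.trans (mul_le_mul_of_nonneg_right ?_ (by positivity))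
  have hsub : F.image f ⊆ Fintype.piFinset fun _ => Finset.range (Nat.log 2 ⌊R⌋₊ + 1) := by
    intro k hk
    obtain ⟨x, hx, rfl⟩ := Finset.mem_image.mp hk
    refine Fintype.mem_piFinset.mpr fun σ => Finset.mem_range.mpr (Nat.lt_succ_of_le
      (Nat.log_mono_right (Nat.floor_le_floor ?_)))
    refine le_trans ?_ (hF x hx).2
    rw [← Finset.mul_prod_erase _ _ (Finset.mem_univ σ)]
    exact le_mul_of_one_le_right (by positivity)
      (Finset.one_le_prod fun τ _ => le_max_left _ _)
  have h3 := Finset.card_le_card hsub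
  rw [Fintype.card_piFinset, Finset.prod_const, Finset.card_range, Finset.card_univ, hcard] at h3
  exact_mod_cast h3

end IntegerCount

/-! ### Lower bound for the number of fields, from Eisenstein polynomials at 2. -/

section Eisenstein

theorem coeff_tuple {R : Type*} [CommRing R] {d : ℕ} (c : Fin d → R) (i : Fin d) :
    (X ^ d + ∑ i : Fin d, C (c i) * X ^ (i : ℕ)).coeff i = c i := by
  rw [coeff_add, coeff_X_pow, if_neg i.2.ne, zero_add, finsetSum_coeff]
  simp only [coeff_C_mul_X_pow]
  rw [Finset.sum_eq_single i]
  · simp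
  · intro j _ hj
    exact if_neg fun h => hj (Fin.ext h.symm)
  · simp

/-- A monic polynomial whose other coefficients are congruent to `2` modulo `4`. -/
noncomputable def eisensteinPoly {d : ℕ} (v : Fin d → ℕ) : ℤ[X] :=
  X ^ d + ∑ i : Fin d, C (4 * (v i : ℤ) + 2) * X ^ (i : ℕ)

theorem eisensteinPoly_monic {d : ℕ} (v : Fin d → ℕ) : (eisensteinPoly v).Monic :=
  (monic_tuple _).1

theorem natDegree_eisensteinPoly {d : ℕ} (v : Fin d → ℕ) : (eisensteinPoly v).natDegree = d :=
  (monic_tuple _).2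

theorem coeff_eisensteinPoly {d : ℕ} (v : Fin d → ℕ) (i : Fin d) :
    (eisensteinPoly v).coeff i = 4 * (v i : ℤ) + 2 := coeff_tuple _ i

theorem eisensteinPoly_injective {d : ℕ} :
    Function.Injective (eisensteinPoly : (Fin d → ℕ) → ℤ[X]) := by
  intro v w h
  funext i
  have h1 := congrArg (fun P : ℤ[X] => P.coeff i) h
  simp only [coeff_eisensteinPoly] at h1
  omega

theorem irreducible_eisensteinPoly {d : ℕ} (hd : 0 < d) (v : Fin d → ℕ) :
    Irreducible (eisensteinPoly v) := by
  have hprime : (Ideal.span {(2 : ℤ)}).IsPrime :=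
    (Ideal.span_singleton_prime two_ne_zero).mpr Int.prime_two
  refine IsEisensteinAt.irreducible (𝓟 := Ideal.span {(2 : ℤ)}) ⟨?_, ?_, ?_⟩ hprime
    (eisensteinPoly_monic v).isPrimitive (by rw [natDegree_eisensteinPoly]; exact hd)
  · rw [(eisensteinPoly_monic v).leadingCoeff]
    exact fun h => hprime.ne_top ((Ideal.eq_top_iff_one _).mpr h)
  · intro i hi
    rw [natDegree_eisensteinPoly] at hi
    rw [coeff_eisensteinPoly v ⟨i, hi⟩, Ideal.mem_span_singleton]
    omega
  · rw [coeff_eisensteinPoly v ⟨0, hd⟩, Ideal.span_singleton_pow, Ideal.mem_span_singleton]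
    omega

theorem isIntMinpoly_of_monic {D : ℤ[X]} (hD : D.Monic) (hirr : Irreducible D) {α : Qbar}
    (hα : aeval α D = 0) : intMinpoly α = D := by
  refine (existsUnique_isIntMinpoly α).unique (intMinpoly_spec α) ⟨hD.isPrimitive, ?_, ?_⟩
  · rw [hD.leadingCoeff]
    exact one_pos
  · have h1 : Irreducible (D.map (algebraMap ℤ ℚ)) :=
      (hD.irreducible_iff_irreducible_map_fraction_map (K := ℚ)).mp hirr
    have h2 := minpoly.eq_of_irreducible_of_monic h1
      (p := D.map (algebraMap ℤ ℚ)) ((aeval_map_algebraMap ℚ α D).trans hα) (hD.map _)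
    rw [hD.leadingCoeff, Int.cast_one, C_1, one_mul, ← h2]
    rfl

theorem exists_aeval_eisensteinPoly {d : ℕ} (hd : 0 < d) (v : Fin d → ℕ) :
    ∃ α : Qbar, aeval α (eisensteinPoly v) = 0 := by
  obtain ⟨α, hα⟩ := IsAlgClosed.exists_root ((eisensteinPoly v).map (algebraMap ℤ Qbar)) (by
    rw [(eisensteinPoly_monic v).degree_map, degree_eq_natDegree (eisensteinPoly_monic v).ne_zero,
      natDegree_eisensteinPoly]
    exact_mod_cast hd.ne')
  exact ⟨α, by rwa [IsRoot.def, eval_map_algebraMap] at hα⟩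

theorem supNorm_eisensteinPoly_le {d m : ℕ} {v : Fin d → ℕ} (hm : 1 ≤ m) (hv : ∀ i, v i < m) :
    (eisensteinPoly v).supNorm ≤ 4 * m := by
  obtain ⟨i, hi⟩ := (eisensteinPoly v).exists_eq_supNorm
  rw [hi]
  have hm' : (1 : ℝ) ≤ m := by exact_mod_cast hm
  rcases lt_trichotomy i d with h | h | h
  · rw [coeff_eisensteinPoly v ⟨i, h⟩, Int.norm_eq_abs]
    have h1 : (v ⟨i, h⟩ : ℝ) + 1 ≤ m := by exact_mod_cast hv ⟨i, h⟩
    push_cast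
    rw [abs_of_nonneg (by positivity)]
    linarith
  · have h1 := (eisensteinPoly_monic v).coeff_natDegree
    rw [natDegree_eisensteinPoly] at h1
    rw [h, h1, norm_one]
    linarith
  · rw [coeff_eq_zero_of_natDegree_lt (by rwa [natDegree_eisensteinPoly]), norm_zero]
    positivity

theorem prod_max_one_le_numberMahler {α : Qbar} {L : IntermediateField ℚ Qbar} [NumberField L]
    (hL : ℚ⟮α⟯ = L) {x : L} (hx : (x : Qbar) = α) :
    ∏ σ : L →+* ℂ, max 1 ‖σ x‖ ≤ numberMahler α := by
  subst hL
  have hxg : x = AdjoinSimple.gen ℚ α := Subtype.ext hx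
  rw [hxg, numberMahler_eq]
  refine le_mul_of_one_le_left (Finset.prod_nonneg fun σ _ => by positivity) ?_
  exact_mod_cast Int.natAbs_pos.mpr (intMinpoly_spec α).2.1.ne'

/-- One root is chosen for each of the `m^d` Eisenstein polynomials; the roots are distinct
algebraic integers of degree `d`. Those generating a given field are integers in it with Mahler
measure at most `√(d+1) X`, so `card_integers_le` bounds how often a field repeats. -/
theorem pow_le_ncard_fieldsOfDegree {d m : ℕ} (hd : 0 < d) (hm : 1 ≤ m) {X : ℝ}
    (hX : 4 * (m : ℝ) ≤ X) :
    (m : ℝ) ^ d ≤ (fieldsOfDegree d X).ncard *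
      (((Nat.log 2 ⌊√(d + 1) * X⌋₊ + 1 : ℕ) : ℝ) ^ d * (12 ^ d * (√(d + 1) * X))) := by
  classical
  set R := √(d + 1) * X with hR
  have hm' : (1 : ℝ) ≤ m := by exact_mod_cast hm
  have hX1 : 1 ≤ X := by linarith
  have hR1 : 1 ≤ R := one_le_mul_of_one_le_of_one_le
    (Real.one_le_sqrt.mpr (by linarith [Nat.cast_nonneg (α := ℝ) d])) hX1
  choose α hα using exists_aeval_eisensteinPoly (d := d) hd
  have hmin : ∀ v, intMinpoly (α v) = eisensteinPoly v := fun v =>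
    isIntMinpoly_of_monic (eisensteinPoly_monic v) (irreducible_eisensteinPoly hd v) (hα v)
  have hdeg : ∀ v, Module.finrank ℚ ℚ⟮α v⟯ = d := fun v => by
    rw [← natDegree_intMinpoly, hmin, natDegree_eisensteinPoly]
  have hinj : Function.Injective α := fun v w h =>
    eisensteinPoly_injective (by rw [← hmin, ← hmin, h])
  let V : Finset (Fin d → ℕ) := Fintype.piFinset fun _ => Finset.range m
  have hnaive : ∀ v ∈ V, naiveHeight (α v) ≤ X := fun v hv => by
    rw [naiveHeight, hmin]
    exact (supNorm_eisensteinPoly_le hm fun i =>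
      Finset.mem_range.mp (Fintype.mem_piFinset.mp hv i)).trans hX
  set W : ℝ := ((Nat.log 2 ⌊R⌋₊ + 1 : ℕ) : ℝ) ^ d * (12 ^ d * R) with hW
  have h1 := card_le_sum_image V (fun v => ℚ⟮α v⟯) (fun _ => W) (by
    intro w _
    set G := V.filter fun v => ℚ⟮α v⟯ = ℚ⟮α w⟯ with hG
    have hmem : ∀ v ∈ G, α v ∈ ℚ⟮α w⟯ := fun v hv =>
      (Finset.mem_filter.mp hv).2 ▸ mem_adjoin_simple_self ℚ (α v)
    let g : {v // v ∈ G} → ℚ⟮α w⟯ := fun v => ⟨α v.1, hmem v.1 v.2⟩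
    have hg : Function.Injective g := fun v v' h =>
      Subtype.ext (hinj (congrArg Subtype.val h))
    have h2 := card_integers_le hR1 (G.attach.image g) (by
      intro x hx
      obtain ⟨v, -, rfl⟩ := Finset.mem_image.mp hx
      obtain ⟨hvV, hvL⟩ := Finset.mem_filter.mp v.2
      constructor
      · have h3 : IsIntegral ℤ (α v.1) := ⟨_, eisensteinPoly_monic v.1, hα v.1⟩
        exact (isIntegral_algebraMap_iff (algebraMap ℚ⟮α w⟯ Qbar).injective).mp h3
      · refine (prod_max_one_le_numberMahler hvL rfl).trans
          ((numberMahler_le_naiveHeight _).trans ?_)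
        rw [hdeg]
        exact mul_le_mul_of_nonneg_left (hnaive _ hvV) (Real.sqrt_nonneg _))
    rwa [Finset.card_image_of_injective _ hg, Finset.card_attach, hdeg] at h2)
  rw [Finset.sum_const, nsmul_eq_mul, Fintype.card_piFinset, Finset.prod_const, Finset.card_range,
    Finset.card_univ, Fintype.card_fin, Nat.cast_pow] at h1
  refine h1.trans (mul_le_mul_of_nonneg_right ?_ (by positivity))
  rw [← Set.ncard_coe_finset]
  refine Nat.cast_le.mpr (Set.ncard_le_ncard ?_ (fieldsOfDegree_finite hd X))
  intro L hL
  obtain ⟨v, hv, rfl⟩ := Finset.mem_image.mp hL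
  exact ⟨hdeg v, (fieldPi_le_naiveHeight _).trans (hnaive v hv)⟩

end Eisenstein

/-! ### Comparison of the two field counts. -/

theorem theorem1p1 :
    (∀ e n : ℕ, 0 < e → 0 < n → ∀ X : ℝ, 0 < X →
      (numbersWithSubfield e n X).Finite ∧
      ((numbersWithSubfield e n X).ncard : ℝ) ≤
        (n * 2 ^ (e * (n ^ 2 + n * e + 2 * e + n + 13) + n ^ 2 + 10 * n)) *
          X ^ (e * n * (n + e))) ∧
    (∀ d : ℕ, 6 < d →
      (∀ X : ℝ, (fieldsOfDegree d X).Finite) ∧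
      (∀ᶠ X : ℝ in Filter.atTop, (fieldsOfDegree d X).Nonempty) ∧
      Filter.Tendsto
        (fun X : ℝ => ((fieldsWithSubfield d X).ncard : ℝ) / ((fieldsOfDegree d X).ncard : ℝ))
        Filter.atTop (nhds 0)) := by
  refine ⟨fun e n he hn X hX => numbersWithSubfield_finite_and_ncard_le he hn hX,
    fun d hd => ⟨fieldsOfDegree_finite (by omega), ?_, ?_⟩⟩
  · filter_upwards [Filter.eventually_ge_atTop 4] with X hX
    have h1 := pow_le_ncard_fieldsOfDegree (d := d) (m := 1) (by omega) le_rfl (X := X)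
      (by simpa using hX)
    rw [Set.nonempty_iff_ne_empty]
    intro h
    rw [h, Set.ncard_empty] at h1
    norm_num at h1
  obtain ⟨C, hC⟩ := exists_ncard_fieldsWithSubfield_le hd
  set s : ℝ := √(d + 1) with hs
  have hs1 : 1 ≤ s := Real.one_le_sqrt.mpr (by linarith [Nat.cast_nonneg (α := ℝ) d])
  -- This majorant is a constant times `(log (2sX))^d / X`, written in terms of `2sX` so that the
  -- limit is that of `(log y)^d / y`.
  have hlim : Filter.Tendsto (fun X : ℝ => C * 8 ^ d * 12 ^ d * s * (2 * s) / Real.log 2 ^ d *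
      (Real.log (2 * s * X) ^ d / (2 * s * X))) Filter.atTop (nhds 0) := by
    have h1 : Filter.Tendsto (fun X : ℝ => 2 * s * X) Filter.atTop Filter.atTop :=
      Filter.tendsto_id.const_mul_atTop (by positivity)
    have h2 := (Real.isLittleO_pow_log_id_atTop (n := d)).tendsto_div_nhds_zero.comp h1
    simpa using h2.const_mul (C * 8 ^ d * 12 ^ d * s * (2 * s) / Real.log 2 ^ d)
  refine squeeze_zero' (Filter.Eventually.of_forall fun X => by positivity) ?_ hlim
  filter_upwards [Filter.eventually_ge_atTop 8] with X hX
  have hX0 : 0 < X := by linarith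
  -- The Eisenstein polynomials have naive height at most `4m`; for `X ≥ 8` also `m ≥ X/8`.
  set m := ⌊X / 4⌋₊ with hm
  have hm1 : 1 ≤ m := Nat.le_floor (by push_cast; linarith)
  have hmX : 4 * (m : ℝ) ≤ X := by
    have := Nat.floor_le (show 0 ≤ X / 4 by positivity)
    linarith
  have hm8 : X / 8 ≤ m := by
    have := Nat.lt_floor_add_one (X / 4)
    rw [← hm] at this
    linarith
  have h1 := pow_le_ncard_fieldsOfDegree (d := d) (by omega) hm1 hmX
  set N : ℝ := ((fieldsOfDegree d X).ncard : ℝ) with hN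
  have hsX : 1 ≤ s * X := one_le_mul_of_one_le_of_one_le hs1 (by linarith)
  have hlog2 : 0 < Real.log 2 := Real.log_pos one_lt_two
  have hlog : ((Nat.log 2 ⌊s * X⌋₊ + 1 : ℕ) : ℝ) ≤ Real.log (2 * s * X) / Real.log 2 := by
    rw [le_div_iff₀ hlog2, ← Real.log_pow]
    refine Real.log_le_log (by positivity) ?_
    have h2 := Nat.pow_log_le_self 2 (Nat.floor_pos.mpr hsX).ne'
    have h3 : (2 : ℝ) ^ Nat.log 2 ⌊s * X⌋₊ ≤ ⌊s * X⌋₊ := by exact_mod_cast h2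
    have h4 := h3.trans (Nat.floor_le (by positivity))
    rw [pow_succ]
    linarith
  set l := Real.log (2 * s * X) / Real.log 2 with hl
  have hl0 : 0 ≤ l := (Nat.cast_nonneg _).trans hlog
  have h5 : (X / 8) ^ d ≤ N * (l ^ d * (12 ^ d * (s * X))) :=
    calc (X / 8) ^ d ≤ (m : ℝ) ^ d := by gcongr
      _ ≤ _ := h1
      _ ≤ _ := by gcongr
  have hNpos : 0 < N := by
    by_contra h
    have h6 : N = 0 := le_antisymm (not_lt.mp h) (Nat.cast_nonneg _)
    rw [h6, zero_mul] at h5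
    exact absurd h5 (not_le.mpr (by positivity))
  have hC0 : 0 ≤ C := by
    have := (Nat.cast_nonneg _).trans (hC 1 le_rfl)
    simpa using this
  rw [div_le_iff₀ hNpos]
  refine (hC X (by linarith)).trans ?_
  have hsplit : X ^ d = X ^ (d - 2) * X ^ 2 := by
    rw [← pow_add]
    congr 1
    omega
  have h7 : X ^ (d - 2) * X ^ 2 ≤ 8 ^ d * (N * (l ^ d * (12 ^ d * (s * X)))) := by
    rw [← hsplit]
    rw [div_pow, div_le_iff₀ (by positivity)] at h5
    linarith
  have h8 : X ^ (d - 2) ≤ 8 ^ d * (N * (l ^ d * (12 ^ d * s))) / X := by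
    rw [le_div_iff₀ hX0]
    refine le_of_mul_le_mul_right ?_ hX0
    calc _ = X ^ (d - 2) * X ^ 2 := by ring
      _ ≤ _ := h7
      _ = _ := by ring
  refine (mul_le_mul_of_nonneg_left h8 hC0).trans_eq ?_
  rw [hl, div_pow]
  field_simp
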